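/- **Setting.** A *signed permutation* of size $n\ge 0$ is a permutation $\tau=\tau(1)\cdots\tau(n)$ of $[n]=\{1,\dots,n\}$ each of whose letters carries a sign $\pm$. For signed permutations $\tau,\tau'$ of sizes $n,n'$ let $\tau\bar\tau'$ be the word $\tau(1)\cdots\tau(n)(\tau'(1)+n)\cdots(\tau'(n')+n)$, each letter keeping its sign, and let $\mathfrak S^{(n,n')}$ be the set of permutations $\pi$ of $[n+n']$ with $\pi(1)<\dots<\pi(n)$ and $\pi(n+1)<\dots<\pi(n+n')$. Put $\tau\mathbin{\overline{\sqcup\!\sqcup}}\tau'=\{(\tau\bar\tau')\circ\pi^{-1}:\pi\in\mathfrak S^{(n,n')}\}$, where signs travel with the values, and $\tau\star\tau'=\{\pi\circ(\tau\bar\tau'):\pi\in\mathfrak S^{(n,n')}\}$, where signs stay at their positions. Over a commutative ring $R$, let $\mathrm{FQSym}_\pm$ be the free module with basis $(\mathbb F_\tau)$ indexed by all signed permutations of all sizes $n\ge 0$, with product, unit and coproduct $$\mathbb F_\tau\cdot\mathbb F_{\tau'}=\sum_{\sigma\in\tau\mathbin{\overline{\sqcup\!\sqcup}}\tau'}\mathbb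 F_\sigma,\qquad 1=\mathbb F_\varnothing,\qquad \Delta\mathbb F_\sigma=\sum_{(\tau,\tau')\,:\,\sigma\in\tau\star\tau'}\mathbb F_\tau\otimes\mathbb F_{\tau'} .$$ **Cambrian trees.** A *Cambrian tree* $S$ with $n\ge 0$ vertices is a finite directed tree consisting of inner vertices bijectively labeled by $[n]$ and of unlabeled leaves, each leaf being incident to exactly one arc, such that every inner vertex $v$ either has exactly one parent and two children (sign $-$) or exactly one child and two parents (sign $+$), and such that, of the two subtrees attached to $v$ through its two children (resp. two parents), one (the left one) contains only labels smaller than the label of $v$ and the other (the right one) only larger labels. (A child of $v$ is the source of an arc into $v$, a parent the target of an arc out of $v$; leaves count as children and parents. For $n=0$ the tree is a single arc.) A *linear extension* of $S$ is a signed permutation $\tau$ of size $n$ in which each value $v$ carries the sign of the vertex $v$ of $S$, and in which $u$ stands before $w$ for every arc $u\to w$ between inner vertices. Set $\mathbb P_S=\sum_\tau\mathbb F_\tau$, summed over the linear extensions $\tau$ of $S$. **Cuts.** A leaf is a *down leaf* if its arc starts there, and an *up leaf* if its arc ends there. A *cut* of $S$ is a set $\gamma$ of arcs (arcs at leaves are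 allowed) such that every directed path of $S$ from a down leaf to an up leaf contains precisely one arc of $\gamma$. An inner vertex lies below $\gamma$ if a directed path leads from it to the source of an arc of $\gamma$, and above $\gamma$ if a directed path leads to it from the target of an arc of $\gamma$. Removing the arcs of $\gamma$ splits $S$ into connected components. Turning each removed arc into a leaf arc at both of its ends and relabeling the inner vertices of each component increasingly by $1,2,\dots$, the components that contain an inner vertex below (resp. above) $\gamma$ form a forest $B(S,\gamma)$ (resp. $A(S,\gamma)$), whose members are ordered from left to right, that is, by the smallest label that they had in $S$. **Proposition.** Let $S$ be a Cambrian tree. For every cut $\gamma$ of $S$, all members of $B(S,\gamma)$ and $A(S,\gamma)$ are Cambrian trees, and $$\Delta\mathbb P_S=\sum_{\gamma}\Bigl(\prod_{T\in B(S,\gamma)}\mathbb P_T\Bigr)\otimes\Bigl(\prod_{T'\in A(S,\gamma)}\mathbb P_{T'}\Bigr),$$ where $\gamma$ runs over all cuts of $S$, the products are taken from left to right, and an empty product is $1$. -/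

import Mathlib

open scoped TensorProduct

/-! ## Signed permutations, shifted shuffle and convolution -/

/-- A signed permutation of size `n`: the word `perm 0, perm 1, …`, together with the signs read by
positions (the p-signature). Positions and values are numbered from `0`. -/
abbrev SignedPermOf (n : ℕ) : Type := Equiv.Perm (Fin n) × (Fin n → ℤˣ)

/-- The set of all signed permutations, of all sizes. -/
abbrev SignedPerm : Type := Σ n : ℕ, SignedPermOf n

namespace SignedPermOf

variable {n m : ℕ}

/-- The v-signature: signs read by values. -/
def vsign (τ : SignedPermOf n) (v : Fin n) : ℤˣ := τ.2 (τ.1.symm v)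

/-- Shifted concatenation; every letter keeps its sign. -/
def concat (τ : SignedPermOf n) (τ' : SignedPermOf m) : SignedPermOf (n + m) :=
  (finSumFinEquiv.permCongr (Equiv.sumCongr τ.1 τ'.1), Fin.append τ.2 τ'.2)

end SignedPermOf

open Classical in
/-- The permutations of `n + m` that increase on the first `n` positions and on the last `m`. -/
noncomputable def grassmannian (n m : ℕ) : Finset (Equiv.Perm (Fin (n + m))) :=
  Finset.univ.filter fun π =>
    StrictMono (fun i : Fin n => π (Fin.castAdd m i)) ∧
    StrictMono (fun j : Fin m => π (Fin.natAdd n j))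

open Classical in
/-- Signed shifted shuffle product `{(τ τ'‾) ∘ π⁻¹}`; signs travel with their values. -/
noncomputable def SignedPerm.shuffle (τ τ' : SignedPerm) : Finset SignedPerm :=
  (grassmannian τ.1 τ'.1).image fun π =>
    ⟨τ.1 + τ'.1, π.symm.trans (τ.2.concat τ'.2).1, fun i => (τ.2.concat τ'.2).2 (π.symm i)⟩

open Classical in
/-- Signed convolution product `{π ∘ (τ τ'‾)}`; signs stay at their positions. -/
noncomputable def SignedPerm.convolution (τ τ' : SignedPerm) : Finset SignedPerm :=
  (grassmannian τ.1 τ'.1).image fun π =>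
    ⟨τ.1 + τ'.1, (τ.2.concat τ'.2).1.trans π, (τ.2.concat τ'.2).2⟩

/-! ## The Hopf algebra of signed permutations -/

/-- The free module with basis the signed permutations. -/
def FQSym (R : Type*) [CommRing R] : Type _ := SignedPerm →₀ R

namespace FQSym

variable (R : Type*) [CommRing R]

noncomputable instance : AddCommGroup (FQSym R) := inferInstanceAs (AddCommGroup (SignedPerm →₀ R))

noncomputable instance : Module R (FQSym R) := inferInstanceAs (Module R (SignedPerm →₀ R))

/-- The basis `(F_τ)`. -/
noncomputable def F : Module.Basis SignedPerm R (FQSym R) := Finsupp.basisSingleOne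

/-- The bilinear product, `F_τ · F_τ' = ∑ F_σ` over `σ` in the shifted shuffle of `τ` and `τ'`. -/
noncomputable def mul : FQSym R →ₗ[R] FQSym R →ₗ[R] FQSym R :=
  (F R).constr R fun τ => (F R).constr R fun τ' => ∑ σ ∈ τ.shuffle τ', F R σ

noncomputable instance : Mul (FQSym R) := ⟨fun x y => mul R x y⟩

/-- The unit is `F` of the empty permutation. -/
noncomputable instance : One (FQSym R) := ⟨F R ⟨0, 1, fun _ => 1⟩⟩

open Classical in
/-- The coproduct, `Δ F_σ = ∑ F_τ ⊗ F_τ'` over the pairs with `σ` in the convolution of `τ` and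
`τ'`. Such pairs have total size the size of `σ`. -/
noncomputable def coproduct : FQSym R →ₗ[R] FQSym R ⊗[R] FQSym R :=
  (F R).constr R fun σ =>
    ∑ ab ∈ Finset.HasAntidiagonal.antidiagonal σ.1, ∑ τ : SignedPermOf ab.1, ∑ τ' : SignedPermOf ab.2,
      if σ ∈ SignedPerm.convolution ⟨ab.1, τ⟩ ⟨ab.2, τ'⟩ then
        F R ⟨ab.1, τ⟩ ⊗ₜ[R] F R ⟨ab.2, τ'⟩
      else 0

end FQSym

/-! ## Cambrian trees -/

/-- A finite directed graph with `size` inner vertices, identified with their labels, and with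
further unlabeled nodes (the leaves). -/
structure LabeledDigraph where
  /-- the number of inner vertices -/
  size : ℕ
  /-- the leaves -/
  Leaf : Type
  leaf_finite : Finite Leaf
  /-- `Arc x y`: there is an arc from `x` (below) to `y` (above). -/
  Arc : Fin size ⊕ Leaf → Fin size ⊕ Leaf → Prop

namespace LabeledDigraph

variable (S : LabeledDigraph)

/-- Inner vertices and leaves. -/
abbrev Node : Type := Fin S.size ⊕ S.Leaf

noncomputable instance : Fintype S.Node :=
  haveI := S.leaf_finite
  Fintype.ofFinite _

/-- The underlying undirected graph. -/
def graph : SimpleGraph S.Node := SimpleGraph.fromRel S.Arc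

/-- The inner vertex `w` lies in the subtree attached to the neighbour `x` of `v`: it is joined to
`x` without passing through `v`. -/
def InBranch (v : Fin S.size) (x : S.Node) (w : Fin S.size) : Prop :=
  ∃ p : S.graph.Walk x (Sum.inl w), Sum.inl v ∉ p.support

/-- `v` has exactly one parent `z` and exactly two children `x` and `y`, whose subtrees bear only
labels smaller, respectively larger, than `v`. -/
def IsNegative (v : Fin S.size) : Prop :=
  ∃ x y z : S.Node, x ≠ y ∧
    (∀ u, S.Arc u (Sum.inl v) ↔ u = x ∨ u = y) ∧
    (∀ u, S.Arc (Sum.inl v) u ↔ u = z) ∧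
    (∀ w, S.InBranch v x w → w < v) ∧
    (∀ w, S.InBranch v y w → v < w)

/-- `v` has exactly one child `z` and exactly two parents `x` and `y`, whose subtrees bear only
labels smaller, respectively larger, than `v`. -/
def IsPositive (v : Fin S.size) : Prop :=
  ∃ x y z : S.Node, x ≠ y ∧
    (∀ u, S.Arc (Sum.inl v) u ↔ u = x ∨ u = y) ∧
    (∀ u, S.Arc u (Sum.inl v) ↔ u = z) ∧
    (∀ w, S.InBranch v x w → w < v) ∧
    (∀ w, S.InBranch v y w → v < w)

/-- Cambrian trees, drawn with their leaves. Without inner vertices, this is a single arc joining a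
down leaf to an up leaf. -/
structure IsCambrian : Prop where
  arc_asymm : ∀ x y, S.Arc x y → ¬ S.Arc y x
  isTree : S.graph.IsTree
  leaf_degree : ∀ l : S.Leaf, ∃! x, S.graph.Adj (Sum.inr l) x
  local_condition : ∀ v, S.IsNegative v ∨ S.IsPositive v

open Classical in
/-- The signature: `-1` at the vertices with two children, `1` at the others. -/
noncomputable def signature (v : Fin S.size) : ℤˣ :=
  if ∃ x y : S.Node, x ≠ y ∧ S.Arc x (Sum.inl v) ∧ S.Arc y (Sum.inl v) then -1 else 1

open Classical in
/-- The linear extensions of `S`: the signed permutations whose v-signature is the signature of `S`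
and in which `u` stands before `w` for every arc `u → w`. -/
noncomputable def linearExtensions : Finset (SignedPermOf S.size) :=
  Finset.univ.filter fun τ =>
    τ.vsign = S.signature ∧
    ∀ u w : Fin S.size, S.Arc (Sum.inl u) (Sum.inl w) → τ.1.symm u < τ.1.symm w

/-- The element `P_S`, the sum of `F_τ` over the linear extensions `τ` of `S`. -/
noncomputable def P (R : Type*) [CommRing R] : FQSym R :=
  ∑ τ ∈ S.linearExtensions, FQSym.F R ⟨S.size, τ⟩

/-! ## Cuts and forests -/

/-- A leaf at which an arc starts. -/
def IsDownLeaf (x : S.Node) : Prop := (∃ l : S.Leaf, x = Sum.inr l) ∧ ∃ y, S.Arc x y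

/-- A leaf at which an arc ends. -/
def IsUpLeaf (x : S.Node) : Prop := (∃ l : S.Leaf, x = Sum.inr l) ∧ ∃ y, S.Arc y x

/-- A path that follows the arcs upwards. -/
def IsVertical {x y : S.Node} (p : S.graph.Walk x y) : Prop :=
  p.IsPath ∧ ∀ d ∈ p.darts, S.Arc d.fst d.snd

/-- A cut: a set of arcs such that every vertical path from a down leaf to an up leaf contains
precisely one of them. -/
def IsCut (γ : Set (S.Node × S.Node)) : Prop :=
  (∀ e ∈ γ, S.Arc e.1 e.2) ∧
  ∀ (x y : S.Node) (p : S.graph.Walk x y), S.IsDownLeaf x → S.IsUpLeaf y → S.IsVertical p →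
    ∃! d, d ∈ p.darts ∧ d.toProd ∈ γ

open Classical in
/-- All cuts of `S`. -/
noncomputable def cuts : Finset (Set (S.Node × S.Node)) := Finset.univ.filter S.IsCut

/-- `v` lies below `γ`: going up from `v` one can reach the lower end of an arc of `γ`. -/
def IsBelow (γ : Set (S.Node × S.Node)) (v : Fin S.size) : Prop :=
  ∃ e ∈ γ, Relation.ReflTransGen S.Arc (Sum.inl v) e.1

/-- `v` lies above `γ`: it can be reached going up from the upper end of an arc of `γ`. -/
def IsAbove (γ : Set (S.Node × S.Node)) (v : Fin S.size) : Prop :=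
  ∃ e ∈ γ, Relation.ReflTransGen S.Arc e.2 (Sum.inl v)

open Classical in
/-- The inner vertices of the connected component of `v` once the arcs of `γ` are removed. -/
noncomputable def component (γ : Set (S.Node × S.Node)) (v : Fin S.size) : Finset (Fin S.size) :=
  Finset.univ.filter fun w =>
    (SimpleGraph.fromRel fun x y => S.Arc x y ∧ (x, y) ∉ γ).Reachable (Sum.inl v) (Sum.inl w)

/-- The part of `S` spanned by the inner vertices in `C`, relabeled increasingly by `0, 1, …`. All
arcs incident to `C` are kept: their ends outside `C` become leaves. -/
def restrict (C : Finset (Fin S.size)) : LabeledDigraph where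
  size := C.card
  Leaf := {x : S.Node // (∀ c ∈ C, x ≠ Sum.inl c) ∧ ∃ c ∈ C, S.graph.Adj (Sum.inl c) x}
  leaf_finite := inferInstance
  Arc x y :=
    let f := Sum.elim (fun i => Sum.inl (C.orderEmbOfFin rfl i)) Subtype.val
    S.Arc (f x) (f y)

open Classical in
/-- The trees, from left to right, into which removing `γ` splits the set of inner vertices
satisfying `Q`. Each of them is listed once, at its smallest vertex. -/
noncomputable def forest (γ : Set (S.Node × S.Node)) (Q : Fin S.size → Prop) :
    List LabeledDigraph :=
  ((Finset.univ.filter fun v => Q v ∧ ∀ w ∈ S.component γ v, v ≤ w).sort (· ≤ ·)).map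
    fun v => S.restrict (S.component γ v)

/-- The forest `B(S, γ)` below `γ`, from left to right. -/
noncomputable def forestBelow (γ : Set (S.Node × S.Node)) : List LabeledDigraph :=
  S.forest γ (S.IsBelow γ)

/-- The forest `A(S, γ)` above `γ`, from left to right. -/
noncomputable def forestAbove (γ : Set (S.Node × S.Node)) : List LabeledDigraph :=
  S.forest γ (S.IsAbove γ)

end LabeledDigraph

/-! The element `P_S` depends only on the signature and on the arcs between inner vertices. So
consider any signs `ε` and any relation `r` on the values, and for a set `I` of values let `E(I)`
(`extSumOn`) be the sum of `F_τ` over the standardized linear extensions of the restriction to `I`.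
Two facts need no trees.

Coproduct (`coproduct_extSum`): splitting a linear extension into a prefix and a suffix makes the
values of the prefix a set `I` closed downwards under `r`; conversely, extensions of `I` and of its
complement concatenate to one of the whole. Hence `Δ E` of all values is the sum of `E(I) ⊗ E(Iᶜ)`
over such `I`.

Product (`extSumOn_mul_extSumOn`): if `I` lies entirely to the left of `J` and `r` relates no
element of one to the other, then every shuffle of extensions is an extension, and `E(I) E(J) = E(I
∪ J)`.

Trees enter in two ways. Cuts correspond to lower sets of inner vertices: a cut gives the vertices
below it, a lower set gives the arcs that leave it, with down leaves counted inside and up leaves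
outside (`isBelow_cutOf`, `isCut_cutOf`, `cutOf_isBelow`). And distinct components of a lower or
upper set occupy label sets one of which is entirely to the left of the other, separated by a vertex
on the path between them (`exists_separator`). So the product over each forest collapses to `E(I)`
or `E(Iᶜ)` (`prod_forest`), and the two sums agree term by term. -/

namespace SignedPermOf

variable {n m : ℕ}

@[simp] theorem concat_castAdd (τ : SignedPermOf n) (τ' : SignedPermOf m) (i : Fin n) :
    (τ.concat τ').1 (Fin.castAdd m i) = Fin.castAdd m (τ.1 i) := by
  simp [concat, Equiv.permCongr_apply]

@[simp] theorem concat_natAdd (τ : SignedPermOf n) (τ' : SignedPermOf m) (j : Fin m) :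
    (τ.concat τ').1 (Fin.natAdd n j) = Fin.natAdd n (τ'.1 j) := by
  simp [concat, Equiv.permCongr_apply]

@[simp] theorem concat_symm_castAdd (τ : SignedPermOf n) (τ' : SignedPermOf m) (i : Fin n) :
    (τ.concat τ').1.symm (Fin.castAdd m i) = Fin.castAdd m (τ.1.symm i) := by
  rw [Equiv.symm_apply_eq, concat_castAdd, Equiv.apply_symm_apply]

@[simp] theorem concat_symm_natAdd (τ : SignedPermOf n) (τ' : SignedPermOf m) (j : Fin m) :
    (τ.concat τ').1.symm (Fin.natAdd n j) = Fin.natAdd n (τ'.1.symm j) := by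
  rw [Equiv.symm_apply_eq, concat_natAdd, Equiv.apply_symm_apply]

@[simp] theorem concat_sign_castAdd (τ : SignedPermOf n) (τ' : SignedPermOf m) (i : Fin n) :
    (τ.concat τ').2 (Fin.castAdd m i) = τ.2 i := by
  simp [concat]

@[simp] theorem concat_sign_natAdd (τ : SignedPermOf n) (τ' : SignedPermOf m) (j : Fin m) :
    (τ.concat τ').2 (Fin.natAdd n j) = τ'.2 j := by
  simp [concat]

theorem concat_injective {τ₁ τ₂ : SignedPermOf n} {τ₁' τ₂' : SignedPermOf m}
    (h : τ₁.concat τ₁' = τ₂.concat τ₂') : τ₁ = τ₂ ∧ τ₁' = τ₂' := by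
  refine ⟨Prod.ext (Equiv.ext fun i => ?_) (funext fun i => ?_),
    Prod.ext (Equiv.ext fun j => ?_) (funext fun j => ?_)⟩
  · simpa using congrArg (fun σ => σ.1 (Fin.castAdd m i)) h
  · simpa using congrArg (fun σ => σ.2 (Fin.castAdd m i)) h
  · simpa using congrArg (fun σ => σ.1 (Fin.natAdd n j)) h
  · simpa using congrArg (fun σ => σ.2 (Fin.natAdd n j)) h

end SignedPermOf

/-! ### Block-increasing permutations and subsets -/

section Merge

variable {n m : ℕ}

/-- The permutation listing the elements of `I`, and then those of its complement. -/
def mergePerm (I : Finset (Fin (n + m))) (h : I.card = n) (h' : Iᶜ.card = m) :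
    Equiv.Perm (Fin (n + m)) :=
  finSumFinEquiv.symm.trans (finSumEquivOfFinset h h')

@[simp] theorem mergePerm_castAdd (I : Finset (Fin (n + m))) (h : I.card = n) (h' : Iᶜ.card = m)
    (i : Fin n) : mergePerm I h h' (Fin.castAdd m i) = I.orderEmbOfFin h i := by
  simp [mergePerm]

@[simp] theorem mergePerm_natAdd (I : Finset (Fin (n + m))) (h : I.card = n) (h' : Iᶜ.card = m)
    (j : Fin m) : mergePerm I h h' (Fin.natAdd n j) = Iᶜ.orderEmbOfFin h' j := by
  simp [mergePerm]

theorem mergePerm_mem_grassmannian (I : Finset (Fin (n + m))) (h : I.card = n)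
    (h' : Iᶜ.card = m) : mergePerm I h h' ∈ grassmannian n m := by
  classical
  simp only [grassmannian, Finset.mem_filter, Finset.mem_univ, true_and, mergePerm_castAdd,
    mergePerm_natAdd]
  exact ⟨(I.orderEmbOfFin h).strictMono, (Iᶜ.orderEmbOfFin h').strictMono⟩

/-- The values of a permutation at the first `n` positions. -/
def headValues (π : Equiv.Perm (Fin (n + m))) : Finset (Fin (n + m)) :=
  Finset.univ.map ((Fin.castAddEmb m).trans π.toEmbedding)

theorem castAdd_mem_headValues (π : Equiv.Perm (Fin (n + m))) (i : Fin n) :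
    π (Fin.castAdd m i) ∈ headValues π := by
  simp [headValues]

theorem natAdd_notMem_headValues (π : Equiv.Perm (Fin (n + m))) (j : Fin m) :
    π (Fin.natAdd n j) ∉ headValues π := by
  simp only [headValues, Finset.mem_map, Finset.mem_univ, true_and, not_exists]
  intro i hi
  have := congrArg Fin.val (π.injective hi)
  simp at this
  omega

theorem card_headValues (π : Equiv.Perm (Fin (n + m))) : (headValues π).card = n := by
  simp [headValues]

theorem card_compl_headValues (π : Equiv.Perm (Fin (n + m))) : (headValues π)ᶜ.card = m := by
  rw [Finset.card_compl, card_headValues, Fintype.card_fin]; omega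

/-- A finite set has only one increasing enumeration, so the values on the first block determine
both blocks. -/
theorem eq_mergePerm {π : Equiv.Perm (Fin (n + m))} (hπ : π ∈ grassmannian n m) :
    π = mergePerm (headValues π) (card_headValues π) (card_compl_headValues π) := by
  classical
  simp only [grassmannian, Finset.mem_filter, Finset.mem_univ, true_and] at hπ
  have h1 := Finset.orderEmbOfFin_unique (card_headValues π) (castAdd_mem_headValues π) hπ.1
  have h2 := Finset.orderEmbOfFin_unique (card_compl_headValues π)
    (fun j => Finset.mem_compl.2 (natAdd_notMem_headValues π j)) hπ.2
  ext x
  induction x using Fin.addCases with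
  | left i => rw [mergePerm_castAdd, ← h1]
  | right j => rw [mergePerm_natAdd, ← h2]

/-- A shifted concatenation permutes positions within each block. This allows `π` to be recovered
from an element of the convolution. -/
theorem headValues_concat_trans (τ : SignedPermOf n) (τ' : SignedPermOf m)
    (π : Equiv.Perm (Fin (n + m))) : headValues ((τ.concat τ').1.trans π) = headValues π := by
  ext x
  simp only [headValues, Finset.mem_map, Finset.mem_univ, true_and]
  constructor
  · rintro ⟨i, rfl⟩
    exact ⟨τ.1 i, by simp⟩
  · rintro ⟨i, rfl⟩
    exact ⟨τ.1.symm i, by simp⟩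

theorem headValues_mergePerm (I : Finset (Fin (n + m))) (h : I.card = n) (h' : Iᶜ.card = m) :
    headValues (mergePerm I h h') = I := by
  refine Finset.eq_of_subset_of_card_le ?_ (by rw [card_headValues, h])
  intro x
  simp only [headValues, Finset.mem_map, Finset.mem_univ, true_and]
  rintro ⟨i, rfl⟩
  simp

/-- Cut the word after `n` letters and standardize both pieces; `π` remembers which values went into
the first. -/
theorem exists_concat_trans (ρ : Equiv.Perm (Fin (n + m))) (s : Fin (n + m) → ℤˣ) :
    ∃ (π : Equiv.Perm (Fin (n + m))) (τ : SignedPermOf n) (τ' : SignedPermOf m),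
      π ∈ grassmannian n m ∧ (τ.concat τ').1.trans π = ρ ∧ (τ.concat τ').2 = s := by
  set I := headValues ρ with hI
  have h := card_headValues ρ
  have h' := card_compl_headValues ρ
  have h1 : ∀ i : Fin n, ∃ k, I.orderEmbOfFin h k = ρ (Fin.castAdd m i) := fun i => by
    have : ρ (Fin.castAdd m i) ∈ Set.range (I.orderEmbOfFin h) := by
      rw [Finset.range_orderEmbOfFin]; exact castAdd_mem_headValues ρ i
    exact this
  have h2 : ∀ j : Fin m, ∃ k, Iᶜ.orderEmbOfFin h' k = ρ (Fin.natAdd n j) := fun j => by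
    have : ρ (Fin.natAdd n j) ∈ Set.range (Iᶜ.orderEmbOfFin h') := by
      rw [Finset.range_orderEmbOfFin]
      exact_mod_cast Finset.mem_compl.2 (natAdd_notMem_headValues ρ j)
    exact this
  choose f hf using h1
  choose g hg using h2
  have hfi : Function.Injective f := fun i j hij => by
    have := hf i
    rw [hij, hf j] at this
    exact (Fin.castAdd_injective n m (ρ.injective this)).symm
  have hgi : Function.Injective g := fun i j hij => by
    have := hg i
    rw [hij, hg j] at this
    exact (Fin.natAdd_injective m n (ρ.injective this)).symm
  refine ⟨mergePerm I h h',
    ⟨Equiv.ofBijective f (Finite.injective_iff_bijective.1 hfi), fun i => s (Fin.castAdd m i)⟩,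
    ⟨Equiv.ofBijective g (Finite.injective_iff_bijective.1 hgi), fun j => s (Fin.natAdd n j)⟩,
    mergePerm_mem_grassmannian I h h', ?_, ?_⟩
  · ext x
    induction x using Fin.addCases with
    | left i => simp [hf]
    | right j => simp [hg]
  · ext x
    induction x using Fin.addCases with
    | left i => simp
    | right j => simp

theorem eq_of_concat_trans_eq {τ₁ τ₂ : SignedPermOf n} {τ₁' τ₂' : SignedPermOf m}
    {π₁ π₂ : Equiv.Perm (Fin (n + m))} (h₁ : π₁ ∈ grassmannian n m) (h₂ : π₂ ∈ grassmannian n m)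
    (h : (τ₁.concat τ₁').1.trans π₁ = (τ₂.concat τ₂').1.trans π₂) : π₁ = π₂ := by
  have : headValues π₁ = headValues π₂ := by
    rw [← headValues_concat_trans τ₁ τ₁', h, headValues_concat_trans]
  rw [eq_mergePerm h₁, eq_mergePerm h₂]
  simp only [this]

end Merge

/-! ## Linear extensions of signed relations -/

open Classical in
/-- The signed permutations with v-signature `ε` in which `u` stands before `w` if `r u w`. -/
noncomputable def linExt {n : ℕ} (ε : Fin n → ℤˣ) (r : Fin n → Fin n → Prop) :
    Finset (SignedPermOf n) :=
  Finset.univ.filter fun τ => τ.vsign = ε ∧ ∀ u w, r u w → τ.1.symm u < τ.1.symm w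

theorem mem_linExt {n : ℕ} {ε : Fin n → ℤˣ} {r : Fin n → Fin n → Prop} {τ : SignedPermOf n} :
    τ ∈ linExt ε r ↔ (∀ v, τ.2 (τ.1.symm v) = ε v) ∧
      ∀ u w, r u w → τ.1.symm u < τ.1.symm w := by
  simp [linExt, funext_iff, SignedPermOf.vsign]

/-- The sum of `F_τ` over the linear extensions `τ`. -/
noncomputable def extSum (R : Type*) [CommRing R] {n : ℕ} (ε : Fin n → ℤˣ)
    (r : Fin n → Fin n → Prop) : FQSym R :=
  ∑ τ ∈ linExt ε r, FQSym.F R ⟨n, τ⟩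

/-- The element `(τ τ'‾) ∘ π⁻¹`. -/
def shuffleElt {n m : ℕ} (τ : SignedPermOf n) (τ' : SignedPermOf m)
    (π : Equiv.Perm (Fin (n + m))) : SignedPermOf (n + m) :=
  (π.symm.trans (τ.concat τ').1, fun i => (τ.concat τ').2 (π.symm i))

theorem shuffleElt_injective {n m : ℕ} {τ₁ τ₂ : SignedPermOf n} {τ₁' τ₂' : SignedPermOf m}
    {π₁ π₂ : Equiv.Perm (Fin (n + m))} (h₁ : π₁ ∈ grassmannian n m) (h₂ : π₂ ∈ grassmannian n m)
    (h : shuffleElt τ₁ τ₁' π₁ = shuffleElt τ₂ τ₂' π₂) : π₁ = π₂ ∧ τ₁ = τ₂ ∧ τ₁' = τ₂' := by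
  have hp := congrArg (fun σ => σ.1.symm) h
  have hs := congrArg Prod.snd h
  -- Inversion turns a shuffle of `τ`, `τ'` into a convolution of their inverses, where `π` is
  -- already known to be determined.
  have e : π₁ = π₂ := by
    refine eq_of_concat_trans_eq (τ₁ := (τ₁.1.symm, τ₁.2)) (τ₁' := (τ₁'.1.symm, τ₁'.2))
      (τ₂ := (τ₂.1.symm, τ₂.2)) (τ₂' := (τ₂'.1.symm, τ₂'.2)) h₁ h₂ ?_
    have key : ∀ (τ : SignedPermOf n) (τ' : SignedPermOf m) (π : Equiv.Perm (Fin (n + m))),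
        (SignedPermOf.concat (τ.1.symm, τ.2) (τ'.1.symm, τ'.2)).1.trans π
          = (shuffleElt τ τ' π).1.symm := by
      intro τ τ' π
      ext x
      induction x using Fin.addCases <;> simp [shuffleElt]
    rw [key, key]
    exact hp
  subst e
  refine ⟨rfl, SignedPermOf.concat_injective (Prod.ext ?_ (funext fun i => ?_))⟩
  · ext x
    simpa [shuffleElt] using congrArg (fun σ => ((σ.1 (π₁ x) : Fin (n + m)) : ℕ)) h
  · simpa [shuffleElt] using congrArg (fun f => f (π₁ i)) hs

theorem FQSym.F_mul_F (R : Type*) [CommRing R] {n m : ℕ} (τ : SignedPermOf n)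
    (τ' : SignedPermOf m) :
    FQSym.F R ⟨n, τ⟩ * FQSym.F R ⟨m, τ'⟩ =
      ∑ π ∈ grassmannian n m, FQSym.F R ⟨n + m, shuffleElt τ τ' π⟩ := by
  classical
  change FQSym.mul R _ _ = _
  rw [FQSym.mul, Module.Basis.constr_basis, Module.Basis.constr_basis, SignedPerm.shuffle,
    Finset.sum_image]
  · rfl
  · intro π₁ h₁ π₂ h₂ h
    exact (shuffleElt_injective (τ₁ := τ) (τ₁' := τ') h₁ h₂ (eq_of_heq (Sigma.mk.inj h).2)).1

/-- A shuffle preserves the order of the letters within each block and `r` imposes nothing across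
blocks, so it is an extension exactly when both factors are. Every signed permutation is such a
shuffle for exactly one triple of factors and `π`. -/
theorem extSum_mul_extSum (R : Type*) [CommRing R] {n m : ℕ} (ε : Fin (n + m) → ℤˣ)
    (r : Fin (n + m) → Fin (n + m) → Prop)
    (h₁ : ∀ i j, ¬ r (Fin.castAdd m i) (Fin.natAdd n j))
    (h₂ : ∀ i j, ¬ r (Fin.natAdd n j) (Fin.castAdd m i)) :
    extSum R (fun i => ε (Fin.castAdd m i)) (fun i i' => r (Fin.castAdd m i) (Fin.castAdd m i')) *
      extSum R (fun j => ε (Fin.natAdd n j)) (fun j j' => r (Fin.natAdd n j) (Fin.natAdd n j')) =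
    extSum R ε r := by
  classical
  have mem_iff : ∀ (τ : SignedPermOf n) (τ' : SignedPermOf m), ∀ π ∈ grassmannian n m,
      (shuffleElt τ τ' π ∈ linExt ε r ↔
        τ ∈ linExt (fun i => ε (Fin.castAdd m i))
          (fun i i' => r (Fin.castAdd m i) (Fin.castAdd m i')) ∧
        τ' ∈ linExt (fun j => ε (Fin.natAdd n j))
          (fun j j' => r (Fin.natAdd n j) (Fin.natAdd n j'))) := by
    intro τ τ' π hπ
    simp only [grassmannian, Finset.mem_filter, Finset.mem_univ, true_and] at hπ
    have hl : ∀ i i', π (Fin.castAdd m i) < π (Fin.castAdd m i') ↔ i < i' :=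
      fun i i' => hπ.1.lt_iff_lt
    have hr : ∀ j j', π (Fin.natAdd n j) < π (Fin.natAdd n j') ↔ j < j' :=
      fun j j' => hπ.2.lt_iff_lt
    simp only [mem_linExt, shuffleElt, Fin.forall_fin_add, Equiv.symm_trans_apply,
      SignedPermOf.concat_symm_castAdd, SignedPermOf.concat_symm_natAdd, Equiv.symm_symm,
      Equiv.symm_apply_apply, SignedPermOf.concat_sign_castAdd, SignedPermOf.concat_sign_natAdd,
      h₁, h₂, false_imp_iff, implies_true, and_true, true_and, hl, hr]
    tauto
  have hmul : ∀ x y : FQSym R, x * y = FQSym.mul R x y := fun _ _ => rfl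
  simp only [extSum, hmul, map_sum, LinearMap.sum_apply]
  simp only [← hmul, FQSym.F_mul_F]
  rw [Finset.sum_comm]
  rw [← Finset.sum_product', ← Finset.sum_product']
  refine Finset.sum_bij (fun p _ => shuffleElt p.1.1 p.1.2 p.2) ?_ ?_ ?_ ?_
  · rintro ⟨⟨τ, τ'⟩, π⟩ h
    simp only [Finset.mem_product] at h
    exact (mem_iff τ τ' π h.2).2 h.1
  · rintro ⟨⟨τ, τ'⟩, π⟩ h ⟨⟨τ₁, τ₁'⟩, π₁⟩ h' e
    simp only [Finset.mem_product] at h h'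
    obtain ⟨rfl, rfl, rfl⟩ := shuffleElt_injective h.2 h'.2 e
    rfl
  · intro σ hσ
    -- Factor the inverse of `σ` as a convolution, then invert the factors and move their signs
    -- accordingly.
    obtain ⟨π, τ, τ', hπ, hρ, hs⟩ := exists_concat_trans σ.1.symm (fun i => σ.2 (σ.1.symm i))
    have key : shuffleElt (τ.1.symm, fun i => τ.2 (τ.1.symm i))
        (τ'.1.symm, fun i => τ'.2 (τ'.1.symm i)) π = σ := by
      have hv : ∀ x, σ.1 (π ((τ.concat τ').1 x)) = x := fun x => by
        rw [← Equiv.trans_apply (τ.concat τ').1 π, hρ, Equiv.apply_symm_apply]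
      have hs' : ∀ x, (τ.concat τ').2 x = σ.2 (π ((τ.concat τ').1 x)) := fun x => by
        rw [← Equiv.trans_apply (τ.concat τ').1 π, hρ, hs]
      refine Prod.ext (Equiv.ext fun x => ?_) (funext fun x => ?_) <;>
        obtain ⟨y, rfl⟩ := π.surjective x <;>
        obtain ⟨z, rfl⟩ := (τ.concat τ').1.surjective y
      · rw [hv]
        induction z using Fin.addCases <;> simp [shuffleElt]
      · rw [← hs']
        induction z using Fin.addCases <;> simp [shuffleElt]
    refine ⟨⟨⟨_, _⟩, π⟩, ?_, key⟩
    rw [← key] at hσ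
    simpa only [Finset.mem_product, hπ, and_true] using (mem_iff _ _ π hπ).1 hσ
  · intros
    rfl

theorem extSum_zero (R : Type*) [CommRing R] (ε : Fin 0 → ℤˣ) (r : Fin 0 → Fin 0 → Prop) :
    extSum R ε r = 1 := by
  have : linExt ε r = {(1, fun _ => 1)} := by
    ext τ
    simp only [mem_linExt, Finset.mem_singleton]
    exact ⟨fun _ => Subsingleton.elim _ _, fun _ => ⟨fun v => v.elim0, fun u => u.elim0⟩⟩
  rw [extSum, this, Finset.sum_singleton]
  rfl

/-! ## Linear extensions on subsets -/

section Subsets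

variable {N : ℕ} (ε : Fin N → ℤˣ) (r : Fin N → Fin N → Prop)

/-- The sum of `F_τ` over the standardized linear extensions of the restriction to `I`. -/
noncomputable def extSumOn (R : Type*) [CommRing R] (I : Finset (Fin N)) : FQSym R :=
  extSum R (fun i => ε (I.orderEmbOfFin rfl i))
    (fun i j => r (I.orderEmbOfFin rfl i) (I.orderEmbOfFin rfl j))

/-- `τ` is a standardized linear extension of the restriction to `I`. -/
def IsExtOn (I : Finset (Fin N)) {k : ℕ} (τ : SignedPermOf k) : Prop :=
  ∃ h : I.card = k, τ ∈ linExt (fun i => ε (I.orderEmbOfFin h i))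
    (fun i j => r (I.orderEmbOfFin h i) (I.orderEmbOfFin h j))

variable (R : Type*) [CommRing R]

/-- Allows the size to be written as a sum, as needed for the types in products. -/
theorem extSumOn_eq {I : Finset (Fin N)} {k : ℕ} (h : I.card = k) :
    extSumOn ε r R I = extSum R (fun i => ε (I.orderEmbOfFin h i))
      (fun i j => r (I.orderEmbOfFin h i) (I.orderEmbOfFin h j)) := by
  subst h
  rfl

theorem extSumOn_empty : extSumOn ε r R ∅ = 1 := by
  rw [extSumOn_eq ε r R Finset.card_empty]
  exact extSum_zero R _ _

theorem extSumOn_mul_extSumOn {I J : Finset (Fin N)} (hlt : ∀ i ∈ I, ∀ j ∈ J, i < j)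
    (h₁ : ∀ i ∈ I, ∀ j ∈ J, ¬ r i j) (h₂ : ∀ i ∈ I, ∀ j ∈ J, ¬ r j i) :
    extSumOn ε r R I * extSumOn ε r R J = extSumOn ε r R (I ∪ J) := by
  have hd : Disjoint I J := Finset.disjoint_left.2 fun x hx hx' => lt_irrefl _ (hlt x hx x hx')
  have hc : (I ∪ J).card = I.card + J.card := Finset.card_union_of_disjoint hd
  -- Since `I` lies to the left of `J`, listing `I` and then `J` lists the union increasingly.
  have e : Fin.append (I.orderEmbOfFin rfl) (J.orderEmbOfFin rfl) = (I ∪ J).orderEmbOfFin hc := by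
    apply Finset.orderEmbOfFin_unique
    · intro x
      induction x using Fin.addCases <;> simp
    · intro x y hxy
      induction x using Fin.addCases with
      | left i =>
        induction y using Fin.addCases with
        | left j =>
          simpa using show i < j from hxy
        | right j => simpa using hlt _ (by simp) _ (by simp)
      | right i =>
        induction y using Fin.addCases with
        | left j =>
          exact absurd hxy (by simp [Fin.lt_def]; omega)
        | right j => simpa using hxy
  rw [extSumOn_eq ε r R hc, ← e, ← extSum_mul_extSum]
  · simp only [Fin.append_left, Fin.append_right]
    rfl
  · intro i j
    simpa using h₁ _ (by simp) _ (by simp)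
  · intro i j
    simpa using h₂ _ (by simp) _ (by simp)

theorem extSumOn_list_prod {ι : Type*} (C : ι → Finset (Fin N)) (l : List ι)
    (h : l.Pairwise fun v w => ∀ i ∈ C v, ∀ j ∈ C w, i < j ∧ ¬ r i j ∧ ¬ r j i)
    (I : Finset (Fin N)) (hI : ∀ x, x ∈ I ↔ ∃ v ∈ l, x ∈ C v) :
    (l.map fun v => extSumOn ε r R (C v)).prod = extSumOn ε r R I := by
  classical
  induction l generalizing I with
  | nil =>
    have : I = ∅ := by ext x; simp [hI]
    simp [this, extSumOn_empty]
  | cons v l ih =>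
    rw [List.pairwise_cons] at h
    obtain ⟨J, hJ⟩ : ∃ J : Finset (Fin N), ∀ x, x ∈ J ↔ ∃ v ∈ l, x ∈ C v :=
      ⟨Finset.univ.filter fun x => ∃ v ∈ l, x ∈ C v, by simp⟩
    have : I = C v ∪ J := by ext x; simp [hI, hJ]
    have hvJ : ∀ i ∈ C v, ∀ j ∈ J, i < j ∧ ¬ r i j ∧ ¬ r j i := by
      intro i hi j hj
      obtain ⟨w, hw, hj⟩ := (hJ j).1 hj
      exact h.1 w hw i hi j hj
    rw [List.map_cons, List.prod_cons, ih h.2 J hJ, this, extSumOn_mul_extSumOn]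
    · exact fun i hi j hj => (hvJ i hi j hj).1
    · exact fun i hi j hj => (hvJ i hi j hj).2.1
    · exact fun i hi j hj => (hvJ i hi j hj).2.2

-- Puts the tensor in the shape of the definition of `FQSym.coproduct`; only the sizes `(I.card,
-- Iᶜ.card)` contribute.
open Classical in
theorem extSumOn_tmul_extSumOn (I : Finset (Fin N)) :
    extSumOn ε r R I ⊗ₜ[R] extSumOn ε r R Iᶜ =
      ∑ ab ∈ Finset.HasAntidiagonal.antidiagonal N, ∑ τ : SignedPermOf ab.1,
        ∑ τ' : SignedPermOf ab.2, if IsExtOn ε r I τ ∧ IsExtOn ε r Iᶜ τ' then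
          FQSym.F R ⟨ab.1, τ⟩ ⊗ₜ[R] FQSym.F R ⟨ab.2, τ'⟩ else 0 := by
  have hN : I.card + Iᶜ.card = N := by simp [Finset.card_add_card_compl]
  rw [Finset.sum_eq_single (I.card, Iᶜ.card)]
  · have h : ∀ (K : Finset (Fin N)) (τ : SignedPermOf K.card), IsExtOn ε r K τ ↔
        τ ∈ linExt (fun i => ε (K.orderEmbOfFin rfl i))
          (fun i j => r (K.orderEmbOfFin rfl i) (K.orderEmbOfFin rfl j)) :=
      fun K τ => ⟨fun h => h.2, fun h => ⟨rfl, h⟩⟩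
    simp only [h, ite_and, extSumOn, extSum, TensorProduct.sum_tmul, TensorProduct.tmul_sum]
    have hs : ∀ (K : Finset (Fin N)) (t : Finset (SignedPermOf K.card))
        (f : SignedPermOf K.card → FQSym R ⊗[R] FQSym R),
        ∑ τ ∈ t, f τ = ∑ τ, if τ ∈ t then f τ else 0 := fun K t f => by
      rw [Finset.sum_ite_mem, Finset.univ_inter]
    rw [Finset.sum_comm, hs]
    refine Finset.sum_congr rfl fun τ _ => ?_
    split_ifs
    · rw [hs]
    · simp
  · rintro ⟨a, b⟩ - hne
    refine Finset.sum_eq_zero fun τ _ => Finset.sum_eq_zero fun τ' _ => if_neg ?_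
    rintro ⟨⟨h, -⟩, ⟨h', -⟩⟩
    exact hne (by rw [h, h'])
  · intro h
    exact absurd (Finset.HasAntidiagonal.mem_antidiagonal.2 hN) h

-- For fixed `τ`, `τ'`, the elements of the convolution are indexed by the set `I` of values at the
-- first `n` positions. A relation from outside `I` into `I` would be violated, one from `I` to
-- outside holds automatically, and those inside `I` or `Iᶜ` are conditions on `τ` or `τ'` alone.
open Classical in
theorem sum_linExt_convolution {n m : ℕ} (ε : Fin (n + m) → ℤˣ)
    (r : Fin (n + m) → Fin (n + m) → Prop) {M : Type*} [AddCommMonoid M]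
    (τ : SignedPermOf n) (τ' : SignedPermOf m) (x : M) :
    (∑ σ ∈ linExt ε r, if (⟨n + m, σ⟩ : SignedPerm) ∈ SignedPerm.convolution ⟨n, τ⟩ ⟨m, τ'⟩
      then x else 0) =
    ∑ I : Finset (Fin (n + m)) with (∀ u w, r u w → w ∈ I → u ∈ I),
      if IsExtOn ε r I τ ∧ IsExtOn ε r Iᶜ τ' then x else 0 := by
  have mem_iff : ∀ (I : Finset (Fin (n + m))) (h : I.card = n) (h' : Iᶜ.card = m),
      ((((τ.concat τ').1.trans (mergePerm I h h'), (τ.concat τ').2) :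
        SignedPermOf (n + m)) ∈ linExt ε r ↔
      (∀ u w, r u w → w ∈ I → u ∈ I) ∧ IsExtOn ε r I τ ∧ IsExtOn ε r Iᶜ τ') := by
    intro I h h'
    have e₁ : IsExtOn ε r I τ ↔ τ ∈ linExt (fun i => ε (I.orderEmbOfFin h i))
        (fun i j => r (I.orderEmbOfFin h i) (I.orderEmbOfFin h j)) :=
      ⟨fun h => h.2, fun k => ⟨h, k⟩⟩
    have e₂ : IsExtOn ε r Iᶜ τ' ↔ τ' ∈ linExt (fun i => ε (Iᶜ.orderEmbOfFin h' i))
        (fun i j => r (Iᶜ.orderEmbOfFin h' i) (Iᶜ.orderEmbOfFin h' j)) :=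
      ⟨fun h => h.2, fun k => ⟨h', k⟩⟩
    -- Splits every quantifier over values into one over `I` and one over its complement.
    have all : ∀ p : Fin (n + m) → Prop, (∀ x, p x) ↔
        (∀ i, p (I.orderEmbOfFin h i)) ∧ ∀ j, p (Iᶜ.orderEmbOfFin h' j) := by
      intro p
      rw [← (mergePerm I h h').forall_congr_right]
      simp only [Fin.forall_fin_add, mergePerm_castAdd, mergePerm_natAdd]
    have s₁ : ∀ i, (mergePerm I h h').symm (I.orderEmbOfFin h i) = Fin.castAdd m i := fun i => by
      rw [Equiv.symm_apply_eq, mergePerm_castAdd]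
    have s₂ : ∀ j, (mergePerm I h h').symm (Iᶜ.orderEmbOfFin h' j) = Fin.natAdd n j := fun j => by
      rw [Equiv.symm_apply_eq, mergePerm_natAdd]
    have m₁ : ∀ i, I.orderEmbOfFin h i ∈ I := fun i => Finset.orderEmbOfFin_mem I h i
    have m₂ : ∀ j, Iᶜ.orderEmbOfFin h' j ∉ I := fun j =>
      Finset.mem_compl.1 (Finset.orderEmbOfFin_mem Iᶜ h' j)
    have lt₁ : ∀ i j, Fin.castAdd m i < Fin.natAdd n j := fun i j => by
      simp [Fin.lt_def]; omega
    have lt₂ : ∀ i j, ¬ Fin.natAdd n j < Fin.castAdd m i := fun i j => (lt₁ i j).le.not_gt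
    rw [e₁, e₂]
    simp only [mem_linExt, all, Equiv.symm_trans_apply, s₁, s₂, m₁, m₂,
      SignedPermOf.concat_symm_castAdd, SignedPermOf.concat_symm_natAdd,
      SignedPermOf.concat_sign_castAdd, SignedPermOf.concat_sign_natAdd, lt₁, lt₂]
    have c₁ : ∀ i i' : Fin n, Fin.castAdd m i < Fin.castAdd m i' ↔ i < i' := fun i i' => Iff.rfl
    have c₂ : ∀ j j' : Fin m, Fin.natAdd n j < Fin.natAdd n j' ↔ j < j' := fun j j' => by simp
    simp only [c₁, c₂, implies_true, and_true, true_and, imp_false, not_true_eq_false,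
      not_false_eq_true, forall_and]
    tauto
  rw [← Finset.sum_filter, ← Finset.sum_filter]
  symm
  have card : ∀ I : Finset (Fin (n + m)),
      I ∈ ({I ∈ ({I | ∀ u w, r u w → w ∈ I → u ∈ I} : Finset (Finset (Fin (n + m)))) |
        IsExtOn ε r I τ ∧ IsExtOn ε r Iᶜ τ'}) → I.card = n ∧ Iᶜ.card = m := by
    intro I hI
    rw [Finset.mem_filter] at hI
    exact ⟨hI.2.1.1, hI.2.2.1⟩
  refine Finset.sum_bij (fun I hI => ((τ.concat τ').1.trans
    (mergePerm I (card I hI).1 (card I hI).2), (τ.concat τ').2)) ?_ ?_ ?_ ?_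
  · intro I hI
    have hI' := hI
    simp only [Finset.mem_filter, Finset.mem_univ, true_and] at hI' ⊢
    refine ⟨(mem_iff I _ _).2 hI', ?_⟩
    rw [SignedPerm.convolution]
    exact Finset.mem_image.2 ⟨_, mergePerm_mem_grassmannian I (card I hI).1 (card I hI).2, rfl⟩
  · intro I hI J hJ e
    have := congrArg (fun σ => headValues σ.1) e
    simpa only [headValues_concat_trans, headValues_mergePerm] using this
  · intro σ hσ
    simp only [Finset.mem_filter] at hσ
    obtain ⟨h, hconv⟩ := hσ
    rw [SignedPerm.convolution] at hconv
    obtain ⟨π, hπ, e⟩ := Finset.mem_image.1 hconv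
    obtain rfl := eq_of_heq (Sigma.mk.inj e).2
    have hm := eq_mergePerm hπ
    refine ⟨headValues π, ?_, ?_⟩
    · have h' := h
      rw [hm, mem_iff] at h'
      simpa only [Finset.mem_filter, Finset.mem_univ, true_and] using h'
    · simp only
      rw [← hm]
  · intros
    rfl

open Classical in
theorem coproduct_extSum :
    FQSym.coproduct R (extSum R ε r) =
      ∑ I : Finset (Fin N) with (∀ u w, r u w → w ∈ I → u ∈ I),
        extSumOn ε r R I ⊗ₜ[R] extSumOn ε r R Iᶜ := by
  simp only [extSum, map_sum, FQSym.coproduct, Module.Basis.constr_basis,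
    extSumOn_tmul_extSumOn]
  rw [Finset.sum_comm, Finset.sum_comm (s := Finset.filter _ _)]
  refine Finset.sum_congr rfl ?_
  rintro ⟨a, b⟩ hab
  obtain rfl := Finset.HasAntidiagonal.mem_antidiagonal.1 hab
  rw [Finset.sum_comm, Finset.sum_comm (s := Finset.filter _ _)]
  refine Finset.sum_congr rfl fun τ _ => ?_
  rw [Finset.sum_comm, Finset.sum_comm (s := Finset.filter _ _)]
  refine Finset.sum_congr rfl fun τ' _ => ?_
  exact sum_linExt_convolution ε r τ τ' _

end Subsets

/-- Prepending `x` to the walk, shortened to a path, gives a path from `x` to its neighbour `z`;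
without cycles its first step must already lead to `z`. -/
theorem SimpleGraph.IsAcyclic.eq_of_adj_of_adj {V : Type*} {G : SimpleGraph V} (hG : G.IsAcyclic)
    {x c z : V} (hc : G.Adj x c) (hz : G.Adj x z) (p : G.Walk c z) (hp : x ∉ p.support) :
    c = z := by
  classical
  have h : (SimpleGraph.Walk.cons hc p.bypass).IsPath :=
    (SimpleGraph.Walk.cons_isPath_iff _ _).2
      ⟨p.bypass_isPath, fun h => hp (p.support_bypass_subset_support h)⟩
  simpa using (hG.eq_snd_of_adj_start h hz (SimpleGraph.Walk.end_mem_support _)).symm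

/-! ### Connection through inner vertices, directed paths and leaves -/

namespace LabeledDigraph

variable {S : LabeledDigraph}

theorem graph_adj {x y : S.Node} : S.graph.Adj x y ↔ x ≠ y ∧ (S.Arc x y ∨ S.Arc y x) :=
  SimpleGraph.fromRel_adj _ _ _

/-- `u` and `w` are joined through inner vertices satisfying `Q`. -/
def JoinedIn (S : LabeledDigraph) (Q : Fin S.size → Prop) (u w : Fin S.size) : Prop :=
  ∃ p : S.graph.Walk (Sum.inl u) (Sum.inl w), ∀ z ∈ p.support, ∃ i, Q i ∧ z = Sum.inl i

theorem JoinedIn.refl {Q : Fin S.size → Prop} {u : Fin S.size} (hu : Q u) : S.JoinedIn Q u u :=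
  ⟨.nil, by simpa using hu⟩

theorem JoinedIn.symm {Q : Fin S.size → Prop} {u w : Fin S.size} (h : S.JoinedIn Q u w) :
    S.JoinedIn Q w u := by
  obtain ⟨p, hp⟩ := h
  exact ⟨p.reverse, by simpa using hp⟩

theorem JoinedIn.trans {Q : Fin S.size → Prop} {u v w : Fin S.size} (h : S.JoinedIn Q u v)
    (h' : S.JoinedIn Q v w) : S.JoinedIn Q u w := by
  obtain ⟨p, hp⟩ := h
  obtain ⟨q, hq⟩ := h'
  refine ⟨p.append q, fun z hz => ?_⟩
  rcases (SimpleGraph.Walk.mem_support_append_iff _ _).1 hz with hz | hz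
  exacts [hp z hz, hq z hz]

theorem JoinedIn.single {Q : Fin S.size → Prop} {u w : Fin S.size} (hu : Q u) (hw : Q w)
    (h : S.graph.Adj (Sum.inl u) (Sum.inl w)) : S.JoinedIn Q u w :=
  ⟨h.toWalk, by simp [hu, hw]⟩

theorem JoinedIn.right {Q : Fin S.size → Prop} {u w : Fin S.size} (h : S.JoinedIn Q u w) :
    Q w := by
  obtain ⟨p, hp⟩ := h
  obtain ⟨i, hi, e⟩ := hp _ p.end_mem_support
  exact (Sum.inl_injective e) ▸ hi

namespace IsCambrian

variable (hS : S.IsCambrian)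
include hS

theorem arc_ne {x y : S.Node} (h : S.Arc x y) : x ≠ y := by
  rintro rfl
  exact hS.arc_asymm _ _ h h

theorem adj_iff {x y : S.Node} : S.graph.Adj x y ↔ S.Arc x y ∨ S.Arc y x := by
  rw [graph_adj]
  exact ⟨fun h => h.2, fun h => ⟨h.elim hS.arc_ne fun h => (hS.arc_ne h).symm, h⟩⟩

theorem adj_of_arc {x y : S.Node} (h : S.Arc x y) : S.graph.Adj x y := hS.adj_iff.2 (Or.inl h)

theorem leaf_unique {l : S.Leaf} {x y : S.Node} (hx : S.graph.Adj (Sum.inr l) x)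
    (hy : S.graph.Adj (Sum.inr l) y) : x = y :=
  (hS.leaf_degree l).unique hx hy

/-- In an acyclic graph a walk is a path as soon as it never backtracks along the edge just used,
and arcs cannot be reversed. -/
theorem isVertical {x y : S.Node} (p : S.graph.Walk x y) (hp : ∀ d ∈ p.darts, S.Arc d.fst d.snd) :
    S.IsVertical p := by
  refine ⟨?_, hp⟩
  rw [hS.isTree.isAcyclic.isPath_iff_isChain]
  induction p with
  | nil => simp
  | cons h q ih =>
    cases q with
    | nil => simp
    | cons h' q =>
      simp only [SimpleGraph.Walk.darts_cons, List.mem_cons, forall_eq_or_imp] at hp ih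
      rw [SimpleGraph.Walk.edges_cons, SimpleGraph.Walk.edges_cons, List.isChain_cons_cons,
        ← SimpleGraph.Walk.edges_cons h' q]
      refine ⟨fun e => ?_, ih hp.2⟩
      rcases Sym2.eq_iff.1 e with ⟨e, -⟩ | ⟨e, -⟩
      · exact h.ne e
      · subst e
        exact hS.arc_asymm _ _ hp.1 hp.2.1

theorem exists_walk {x y : S.Node} (h : Relation.ReflTransGen S.Arc x y) :
    ∃ p : S.graph.Walk x y, ∀ d ∈ p.darts, S.Arc d.fst d.snd := by
  induction h using Relation.ReflTransGen.head_induction_on with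
  | refl => exact ⟨.nil, by simp⟩
  | head h _ ih =>
    obtain ⟨p, hp⟩ := ih
    exact ⟨.cons (hS.adj_of_arc h) p, by simpa using ⟨h, hp⟩⟩

theorem not_transGen_self (x : S.Node) : ¬ Relation.TransGen S.Arc x x := by
  intro h
  obtain ⟨y, h, h'⟩ := Relation.TransGen.head'_iff.1 h
  obtain ⟨p, hp⟩ := hS.exists_walk h'
  have := (hS.isVertical (.cons (hS.adj_of_arc h) p) (by simpa using ⟨h, hp⟩)).1
  simp at this

theorem wellFounded_arc : WellFounded S.Arc := by
  have : Std.Irrefl (Relation.TransGen S.Arc) := ⟨hS.not_transGen_self⟩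
  exact Subrelation.wf (fun h => Relation.TransGen.single h)
    (Finite.wellFounded_of_trans_of_irrefl (Relation.TransGen S.Arc))

theorem wellFounded_swap_arc : WellFounded fun x y => S.Arc y x := by
  have : Std.Irrefl (Function.swap (Relation.TransGen S.Arc)) := ⟨hS.not_transGen_self⟩
  exact Subrelation.wf (fun h => Relation.TransGen.single h)
    (Finite.wellFounded_of_trans_of_irrefl (Function.swap (Relation.TransGen S.Arc)))

theorem exists_parent (v : Fin S.size) : ∃ z, S.Arc (Sum.inl v) z := by
  rcases hS.local_condition v with ⟨x, y, z, -, -, h, -⟩ | ⟨x, y, z, -, h, -⟩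
  exacts [⟨z, (h z).2 rfl⟩, ⟨x, (h x).2 (Or.inl rfl)⟩]

theorem exists_child (v : Fin S.size) : ∃ z, S.Arc z (Sum.inl v) := by
  rcases hS.local_condition v with ⟨x, y, z, -, h, -⟩ | ⟨x, y, z, -, -, h, -⟩
  exacts [⟨x, (h x).2 (Or.inl rfl)⟩, ⟨z, (h z).2 rfl⟩]

theorem exists_upLeaf {x y : S.Node} (h : S.Arc x y) :
    ∃ z, S.IsUpLeaf z ∧ Relation.ReflTransGen S.Arc y z := by
  induction y using hS.wellFounded_swap_arc.induction generalizing x with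
  | h y ih =>
    rcases y with v | l
    · obtain ⟨z, hz⟩ := hS.exists_parent v
      obtain ⟨t, ht, hzt⟩ := ih z hz hz
      exact ⟨t, ht, .head hz hzt⟩
    · exact ⟨_, ⟨⟨l, rfl⟩, x, h⟩, .refl⟩

theorem exists_downLeaf {x y : S.Node} (h : S.Arc x y) :
    ∃ z, S.IsDownLeaf z ∧ Relation.ReflTransGen S.Arc z x := by
  induction x using hS.wellFounded_arc.induction generalizing y with
  | h x ih =>
    rcases x with v | l
    · obtain ⟨z, hz⟩ := hS.exists_child v
      obtain ⟨t, ht, hzt⟩ := ih z hz hz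
      exact ⟨t, ht, .tail hzt hz⟩
    · exact ⟨_, ⟨⟨l, rfl⟩, y, h⟩, .refl⟩

/-! ### Separation of components -/

/-- Some `u` on the path from `x` to `y` lies outside `K` and is reached from both sides along `A`.
The two components avoid `u`, hence lie in different branches at `u`, and the label of `u` separates
them. Here `A` is `Arc` for lower sets and its reverse for upper sets. -/
theorem exists_separator {A : S.Node → S.Node → Prop}
    (hA : ∀ x y, S.graph.Adj x y ↔ A x y ∨ A y x) (wf : WellFounded fun x y => A y x)
    (hbr : ∀ u a b, a ≠ b → A a (Sum.inl u) → A b (Sum.inl u) →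
      ((∀ w, S.InBranch u a w → w < u) ∧ ∀ w, S.InBranch u b w → u < w) ∨
      ((∀ w, S.InBranch u b w → w < u) ∧ ∀ w, S.InBranch u a w → u < w))
    {K : Fin S.size → Prop} (hK : ∀ i j, A (Sum.inl i) (Sum.inl j) → K j → K i)
    {x y : Fin S.size} (hx : K x) (hy : K y) (hxy : ¬ S.JoinedIn K x y) :
    (∀ x' y', S.JoinedIn K x x' → S.JoinedIn K y y' → x' < y') ∨
    (∀ x' y', S.JoinedIn K x x' → S.JoinedIn K y y' → y' < x') := by
  classical
  obtain ⟨p, hp⟩ := (hS.isTree.connected (Sum.inl x) (Sum.inl y)).exists_isPath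
  have hne : {z | z ∈ p.support ∧ ¬ ∃ i, K i ∧ z = Sum.inl i}.Nonempty := by
    by_contra h
    refine hxy ⟨p, fun z hz => ?_⟩
    by_contra hz'
    exact h ⟨z, hz, hz'⟩
  obtain ⟨u, ⟨hu, huK⟩, hmin⟩ := wf.has_min _ hne
  obtain ⟨q, r, rfl⟩ := SimpleGraph.Walk.mem_support_iff_exists_append.1 hu
  have hq := hp.of_append_left
  have hr := hp.of_append_right
  have hq' := hq.reverse
  generalize hqr : q.reverse = q' at hq'
  cases q' with
  | nil => exact absurd ⟨x, hx, rfl⟩ huK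
  | @cons _ a _ hua q' =>
  cases r with
  | nil => exact absurd ⟨y, hy, rfl⟩ huK
  | @cons _ b _ hub r =>
  have haq : a ∈ q.support := by
    rw [← List.mem_reverse, ← SimpleGraph.Walk.support_reverse, hqr]
    simp
  have hab : a ≠ b := hp.ne_of_mem_support_of_append hub.ne' haq (by simp)
  -- An `A`-arc from `u` to `c` would force `c` into `K` by the choice of `u`, hence `u` too if `u`
  -- is inner; and a leaf cannot have two neighbours on the path.
  have key : ∀ c, S.graph.Adj u c → c ∈ (q.append (.cons hub r)).support → A c u := by
    intro c huc hc
    rcases (hA _ _).1 huc with h | h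
    · have hcK : ∃ i, K i ∧ c = Sum.inl i := by
        by_contra hcK
        exact hmin c ⟨hc, hcK⟩ h
      obtain ⟨i, hi, rfl⟩ := hcK
      rcases u with u | l
      · exact absurd ⟨u, hK _ _ h hi, rfl⟩ huK
      · exact absurd (hS.leaf_unique hua hub) hab
    · exact h
  have hau := key a hua (by simp [SimpleGraph.Walk.mem_support_append_iff, haq])
  have hbu := key b hub (by simp [SimpleGraph.Walk.mem_support_append_iff])
  rcases u with u | l
  swap
  · exact absurd (hS.leaf_unique hua hub) hab
  rw [SimpleGraph.Walk.cons_isPath_iff] at hq' hr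
  have branch : ∀ {c : S.Node} {v w : Fin S.size} (s : S.graph.Walk c (Sum.inl v)),
      Sum.inl u ∉ s.support → S.JoinedIn K v w → S.InBranch u c w := by
    rintro c v w s hs ⟨t, ht⟩
    refine ⟨s.append t, fun h => ?_⟩
    rcases (SimpleGraph.Walk.mem_support_append_iff _ _).1 h with h | h
    exacts [hs h, huK (ht _ h)]
  rcases hbr u a b hab hau hbu with ⟨h, h'⟩ | ⟨h, h'⟩
  · exact Or.inl fun x' y' hx' hy' =>
      (h _ (branch q' hq'.2 hx')).trans (h' _ (branch r hr.2 hy'))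
  · exact Or.inr fun x' y' hx' hy' =>
      (h _ (branch r hr.2 hy')).trans (h' _ (branch q' hq'.2 hx'))

theorem branch_of_children (u : Fin S.size) (a b : S.Node) (hab : a ≠ b)
    (ha : S.Arc a (Sum.inl u)) (hb : S.Arc b (Sum.inl u)) :
    ((∀ w, S.InBranch u a w → w < u) ∧ ∀ w, S.InBranch u b w → u < w) ∨
    ((∀ w, S.InBranch u b w → w < u) ∧ ∀ w, S.InBranch u a w → u < w) := by
  rcases hS.local_condition u with ⟨x, y, z, -, h, -, hl, hr⟩ | ⟨x, y, z, -, -, h, -⟩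
  · rcases (h a).1 ha with rfl | rfl <;> rcases (h b).1 hb with rfl | rfl
    exacts [absurd rfl hab, Or.inl ⟨hl, hr⟩, Or.inr ⟨hl, hr⟩, absurd rfl hab]
  · exact absurd (((h a).1 ha).trans ((h b).1 hb).symm) hab

theorem branch_of_parents (u : Fin S.size) (a b : S.Node) (hab : a ≠ b)
    (ha : S.Arc (Sum.inl u) a) (hb : S.Arc (Sum.inl u) b) :
    ((∀ w, S.InBranch u a w → w < u) ∧ ∀ w, S.InBranch u b w → u < w) ∨
    ((∀ w, S.InBranch u b w → w < u) ∧ ∀ w, S.InBranch u a w → u < w) := by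
  rcases hS.local_condition u with ⟨x, y, z, -, -, h, -⟩ | ⟨x, y, z, -, h, -, hl, hr⟩
  · exact absurd (((h a).1 ha).trans ((h b).1 hb).symm) hab
  · rcases (h a).1 ha with rfl | rfl <;> rcases (h b).1 hb with rfl | rfl
    exacts [absurd rfl hab, Or.inl ⟨hl, hr⟩, Or.inr ⟨hl, hr⟩, absurd rfl hab]

theorem separated_of_lower {K : Fin S.size → Prop}
    (hK : ∀ i j, S.Arc (Sum.inl i) (Sum.inl j) → K j → K i)
    {x y : Fin S.size} (hx : K x) (hy : K y) (hxy : ¬ S.JoinedIn K x y) :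
    (∀ x' y', S.JoinedIn K x x' → S.JoinedIn K y y' → x' < y') ∨
    (∀ x' y', S.JoinedIn K x x' → S.JoinedIn K y y' → y' < x') :=
  hS.exists_separator (A := S.Arc) (fun _ _ => hS.adj_iff) hS.wellFounded_swap_arc
    hS.branch_of_children hK hx hy hxy

theorem separated_of_upper {K : Fin S.size → Prop}
    (hK : ∀ i j, S.Arc (Sum.inl i) (Sum.inl j) → K i → K j)
    {x y : Fin S.size} (hx : K x) (hy : K y) (hxy : ¬ S.JoinedIn K x y) :
    (∀ x' y', S.JoinedIn K x x' → S.JoinedIn K y y' → x' < y') ∨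
    (∀ x' y', S.JoinedIn K x x' → S.JoinedIn K y y' → y' < x') :=
  hS.exists_separator (A := fun x y => S.Arc y x) (fun _ _ => hS.adj_iff.trans or_comm)
    hS.wellFounded_arc hS.branch_of_parents (fun i j h => hK j i h) hx hy hxy

end IsCambrian

/-! ### Restriction to a connected set of inner vertices -/

/-- The inclusion of the nodes of `S.restrict C`. -/
def restrictNode (S : LabeledDigraph) (C : Finset (Fin S.size)) :
    (S.restrict C).Node → S.Node :=
  Sum.elim (fun i => Sum.inl (C.orderEmbOfFin rfl i)) Subtype.val

theorem restrict_arc {C : Finset (Fin S.size)} {x y : (S.restrict C).Node} :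
    (S.restrict C).Arc x y ↔ S.Arc (S.restrictNode C x) (S.restrictNode C y) := Iff.rfl

theorem restrictNode_injective (C : Finset (Fin S.size)) :
    Function.Injective (S.restrictNode C) := by
  rintro (i | l) (j | l') h
  · have h' : C.orderEmbOfFin rfl i = C.orderEmbOfFin rfl j := Sum.inl_injective h
    rw [(C.orderEmbOfFin rfl).injective h']
  · exact absurd h.symm (l'.2.1 _ (Finset.orderEmbOfFin_mem C rfl i))
  · exact absurd h (l.2.1 _ (Finset.orderEmbOfFin_mem C rfl j))
  · exact congrArg Sum.inr (Subtype.ext h)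

theorem exists_restrictNode_inl {C : Finset (Fin S.size)} {c : Fin S.size} (hc : c ∈ C) :
    ∃ i, S.restrictNode C (Sum.inl i) = Sum.inl c := by
  have : c ∈ Set.range (C.orderEmbOfFin rfl) := by rwa [Finset.range_orderEmbOfFin]
  obtain ⟨i, rfl⟩ := this
  exact ⟨i, rfl⟩

theorem exists_restrictNode_of_adj {C : Finset (Fin S.size)} {c : Fin S.size} (hc : c ∈ C)
    {x : S.Node} (h : S.graph.Adj (Sum.inl c) x) : ∃ x', S.restrictNode C x' = x := by
  by_cases hx : ∃ c ∈ C, x = Sum.inl c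
  · obtain ⟨c, hc, rfl⟩ := hx
    obtain ⟨i, hi⟩ := exists_restrictNode_inl hc
    exact ⟨_, hi⟩
  · exact ⟨Sum.inr ⟨x, fun c hc e => hx ⟨c, hc, e⟩, c, hc, h⟩, rfl⟩

theorem restrict_adj {C : Finset (Fin S.size)} {x y : (S.restrict C).Node} :
    (S.restrict C).graph.Adj x y ↔ S.graph.Adj (S.restrictNode C x) (S.restrictNode C y) := by
  rw [graph_adj, graph_adj, (restrictNode_injective C).ne_iff, restrict_arc, restrict_arc]

/-- The inclusion of `S.restrict C` as a homomorphism of undirected graphs. -/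
def restrictHom (S : LabeledDigraph) (C : Finset (Fin S.size)) :
    (S.restrict C).graph →g S.graph where
  toFun := S.restrictNode C
  map_rel' h := restrict_adj.1 h

theorem reachable_restrict {C : Finset (Fin S.size)} {x y : S.Node} (p : S.graph.Walk x y)
    (hp : ∀ z ∈ p.support, ∃ i ∈ C, z = Sum.inl i) {x' y' : (S.restrict C).Node}
    (hx : S.restrictNode C x' = x) (hy : S.restrictNode C y' = y) :
    (S.restrict C).graph.Reachable x' y' := by
  induction p generalizing x' with
  | nil => rw [restrictNode_injective C (hx.trans hy.symm)]
  | cons h q ih =>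
    obtain ⟨i, hi, e⟩ := hp _ (List.mem_cons_of_mem _ q.start_mem_support)
    obtain ⟨i', hi'⟩ := exists_restrictNode_inl hi
    have h' : (S.restrict C).graph.Adj x' (Sum.inl i') := by
      rw [restrict_adj, hx, hi', ← e]
      exact h
    exact h'.reachable.trans
      (ih (fun z hz => hp z (List.mem_cons_of_mem _ hz)) (hi'.trans e.symm) hy)

theorem exists_walk_restrictNode {C : Finset (Fin S.size)} {x y : (S.restrict C).Node}
    (p : (S.restrict C).graph.Walk x y) :
    ∃ q : S.graph.Walk (S.restrictNode C x) (S.restrictNode C y),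
      q.support = p.support.map (S.restrictNode C) :=
  ⟨p.map (S.restrictHom C), SimpleGraph.Walk.support_map _ _⟩

theorem InBranch.of_restrict {C : Finset (Fin S.size)} {v w : Fin C.card}
    {x : (S.restrict C).Node} (h : (S.restrict C).InBranch v x w) :
    S.InBranch (C.orderEmbOfFin rfl v) (S.restrictNode C x) (C.orderEmbOfFin rfl w) := by
  obtain ⟨p, hp⟩ := h
  obtain ⟨q, hq⟩ := exists_walk_restrictNode p
  refine ⟨q, fun h => ?_⟩
  obtain ⟨z, hz, e⟩ := List.mem_map.1 (hq ▸ h)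
  have : z = Sum.inl v := restrictNode_injective C e
  exact hp (this ▸ hz)

/-- The restriction embeds in `S`, so it has no cycles. Each vertex of `C` keeps all its arcs and
its branches only shrink, so the local condition is inherited. -/
theorem IsCambrian.restrict (hS : S.IsCambrian) {C : Finset (Fin S.size)} (hne : C.Nonempty)
    (hC : ∀ u ∈ C, ∀ w ∈ C, S.JoinedIn (· ∈ C) u w) : (S.restrict C).IsCambrian where
  arc_asymm x y h h' := hS.arc_asymm _ _ h h'
  isTree := by
    have reach : ∀ u w : Fin C.card, (S.restrict C).graph.Reachable (Sum.inl u) (Sum.inl w) := by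
      intro u w
      obtain ⟨p, hp⟩ := hC _ (Finset.orderEmbOfFin_mem C rfl u) _
        (Finset.orderEmbOfFin_mem C rfl w)
      exact reachable_restrict p hp rfl rfl
    have inner : ∀ x : (S.restrict C).Node, ∃ u : Fin C.card,
        (S.restrict C).graph.Reachable x (Sum.inl u) := by
      rintro (u | l)
      · exact ⟨u, .refl _⟩
      · obtain ⟨c, hc, h⟩ := l.2.2
        obtain ⟨i, hi⟩ := exists_restrictNode_inl hc
        refine ⟨i, SimpleGraph.Adj.reachable (restrict_adj.2 ?_)⟩
        rw [hi]
        exact h.symm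
    have : Nonempty (S.restrict C).Node := ⟨Sum.inl ⟨0, hne.card_pos⟩⟩
    refine ⟨⟨fun x y => ?_⟩,
      hS.isTree.isAcyclic.comap (S.restrictHom C) (restrictNode_injective C)⟩
    obtain ⟨u, hu⟩ := inner x
    obtain ⟨w, hw⟩ := inner y
    exact (hu.trans (reach u w)).trans hw.symm
  leaf_degree l := by
    obtain ⟨c, hc, h⟩ := l.2.2
    obtain ⟨i, hi⟩ := exists_restrictNode_inl hc
    refine ⟨Sum.inl i, restrict_adj.2 (by rw [hi]; exact h.symm), fun z hz => ?_⟩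
    apply restrictNode_injective C
    rw [hi]
    have hz' : S.graph.Adj l.1 (S.restrictNode C z) := restrict_adj.1 hz
    -- A second neighbour of the leaf would be joined to `c` without using the leaf, closing a
    -- cycle.
    have avoid : ∀ c' ∈ C, ∃ p : S.graph.Walk (Sum.inl c) (Sum.inl c'), l.1 ∉ p.support := by
      intro c' hc'
      obtain ⟨p, hp⟩ := hC c hc c' hc'
      refine ⟨p, fun hl => ?_⟩
      obtain ⟨k, hk, e⟩ := hp _ hl
      exact l.2.1 k hk e
    suffices ∃ p : S.graph.Walk (Sum.inl c) (S.restrictNode C z), l.1 ∉ p.support by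
      obtain ⟨p, hp⟩ := this
      exact (hS.isTree.isAcyclic.eq_of_adj_of_adj h.symm hz' p hp).symm
    rcases z with j | l'
    · exact avoid _ (Finset.orderEmbOfFin_mem C rfl j)
    -- A neighbour that is itself a leaf of the restriction is one step away from `C`.
    · obtain ⟨c', hc', h'⟩ := l'.2.2
      obtain ⟨p, hp⟩ := avoid c' hc'
      have hl : l.1 ∉ (p.concat h').support := by
        have hne : l.1 ≠ l'.1 := hz'.ne
        rw [SimpleGraph.Walk.support_concat, List.mem_append,
          List.mem_singleton]
        exact fun hl => hl.elim hp hne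
      exact ⟨p.concat h', hl⟩
  local_condition v := by
    have hv := Finset.orderEmbOfFin_mem C rfl v
    have mono : ∀ {i j : Fin C.card}, C.orderEmbOfFin rfl i < C.orderEmbOfFin rfl j → i < j :=
      fun h => (C.orderEmbOfFin rfl).lt_iff_lt.1 h
    have surj : ∀ x, S.graph.Adj (Sum.inl (C.orderEmbOfFin rfl v)) x →
        ∃ x', S.restrictNode C x' = x := fun x hx => exists_restrictNode_of_adj hv hx
    have inj : ∀ x y, S.restrictNode C x = S.restrictNode C y ↔ x = y :=
      fun x y => (restrictNode_injective C).eq_iff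
    rcases hS.local_condition (C.orderEmbOfFin rfl v) with
      ⟨x, y, z, hxy, h, h', hl, hr⟩ | ⟨x, y, z, hxy, h, h', hl, hr⟩
    · obtain ⟨x, rfl⟩ := surj x (hS.adj_of_arc ((h x).2 (Or.inl rfl))).symm
      obtain ⟨y, rfl⟩ := surj y (hS.adj_of_arc ((h y).2 (Or.inr rfl))).symm
      obtain ⟨z, rfl⟩ := surj z (hS.adj_of_arc ((h' z).2 rfl))
      refine Or.inl ⟨x, y, z, fun e => hxy (e ▸ rfl), fun u => ?_, fun u => ?_,
        fun w hw => mono (hl _ hw.of_restrict), fun w hw => mono (hr _ hw.of_restrict)⟩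
      · exact (h (S.restrictNode C u)).trans (or_congr (inj _ _) (inj _ _))
      · exact (h' (S.restrictNode C u)).trans (inj _ _)
    · obtain ⟨x, rfl⟩ := surj x (hS.adj_of_arc ((h x).2 (Or.inl rfl)))
      obtain ⟨y, rfl⟩ := surj y (hS.adj_of_arc ((h y).2 (Or.inr rfl)))
      obtain ⟨z, rfl⟩ := surj z (hS.adj_of_arc ((h' z).2 rfl)).symm
      refine Or.inr ⟨x, y, z, fun e => hxy (e ▸ rfl), fun u => ?_, fun u => ?_,
        fun w hw => mono (hl _ hw.of_restrict), fun w hw => mono (hr _ hw.of_restrict)⟩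
      · exact (h (S.restrictNode C u)).trans (or_congr (inj _ _) (inj _ _))
      · exact (h' (S.restrictNode C u)).trans (inj _ _)

theorem IsCambrian.signature_restrict (hS : S.IsCambrian) (C : Finset (Fin S.size))
    (i : Fin C.card) :
    (S.restrict C).signature i = S.signature (C.orderEmbOfFin rfl i) := by
  have hi := Finset.orderEmbOfFin_mem C rfl i
  unfold signature
  congr 1
  rw [eq_iff_iff]
  constructor
  · rintro ⟨x, y, hxy, hx, hy⟩
    exact ⟨_, _, fun e => hxy (restrictNode_injective C e), hx, hy⟩
  · rintro ⟨x, y, hxy, hx, hy⟩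
    obtain ⟨x, rfl⟩ := exists_restrictNode_of_adj hi (hS.adj_of_arc hx).symm
    obtain ⟨y, rfl⟩ := exists_restrictNode_of_adj hi (hS.adj_of_arc hy).symm
    exact ⟨x, y, fun e => hxy (e ▸ rfl), hx, hy⟩

/-- The arcs between inner vertices. -/
def InnerArc (S : LabeledDigraph) (u w : Fin S.size) : Prop := S.Arc (Sum.inl u) (Sum.inl w)

theorem P_eq_extSum (S : LabeledDigraph) (R : Type*) [CommRing R] :
    S.P R = extSum R S.signature S.InnerArc := rfl

theorem IsCambrian.P_restrict (hS : S.IsCambrian) (R : Type*) [CommRing R]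
    (C : Finset (Fin S.size)) :
    (S.restrict C).P R = extSumOn S.signature S.InnerArc R C := by
  rw [P_eq_extSum, funext (hS.signature_restrict C)]
  rfl

/-! ### Components -/

/-- A leaf has a single neighbour, so connections between inner vertices never need to pass through
leaves. -/
theorem IsCambrian.mem_component_iff (hS : S.IsCambrian) {γ : Set (S.Node × S.Node)}
    {v w : Fin S.size} :
    w ∈ S.component γ v ↔ Relation.ReflTransGen (fun i j : Fin S.size =>
      (S.Arc (Sum.inl i) (Sum.inl j) ∧ (Sum.inl i, Sum.inl j) ∉ γ) ∨
      (S.Arc (Sum.inl j) (Sum.inl i) ∧ (Sum.inl j, Sum.inl i) ∉ γ)) v w := by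
  set G : SimpleGraph S.Node := SimpleGraph.fromRel fun x y => S.Arc x y ∧ (x, y) ∉ γ with hG
  have hadj : ∀ x y, G.Adj x y ↔ (S.Arc x y ∧ (x, y) ∉ γ) ∨ (S.Arc y x ∧ (y, x) ∉ γ) := by
    intro x y
    rw [hG, SimpleGraph.fromRel_adj]
    exact ⟨fun h => h.2, fun h =>
      ⟨h.elim (fun h => hS.arc_ne h.1) fun h => (hS.arc_ne h.1).symm, h⟩⟩
  have hle : ∀ {x y}, G.Adj x y → S.graph.Adj x y := fun h =>
    hS.adj_iff.2 (((hadj _ _).1 h).imp And.left And.left)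
  simp only [component, Finset.mem_filter, Finset.mem_univ, true_and, ← hadj]
  rw [← hG]
  constructor
  · intro h
    rw [SimpleGraph.reachable_iff_reflTransGen] at h
    -- For the induction, a walk standing at a leaf remembers the inner vertex next to it, to which
    -- it must return.
    suffices ∀ y, Relation.ReflTransGen G.Adj (Sum.inl v) y →
        (∀ w, y = Sum.inl w →
          Relation.ReflTransGen (fun i j : Fin S.size => G.Adj (Sum.inl i) (Sum.inl j)) v w) ∧
        (∀ l, y = Sum.inr l → ∃ w, G.Adj (Sum.inl w) (Sum.inr l) ∧
          Relation.ReflTransGen (fun i j : Fin S.size => G.Adj (Sum.inl i) (Sum.inl j)) v w) from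
      (this _ h).1 w rfl
    intro y hy
    induction hy with
    | refl =>
      refine ⟨fun w e => ?_, fun l e => by simp at e⟩
      rw [Sum.inl_injective e]
    | @tail y z _ hyz ih =>
      rcases y with u | l
      · have hu := ih.1 u rfl
        refine ⟨fun w e => ?_, fun l e => ⟨u, e ▸ hyz, hu⟩⟩
        subst e
        exact hu.tail hyz
      · obtain ⟨u, hul, hu⟩ := ih.2 l rfl
        obtain rfl := hS.leaf_unique (hle hul).symm (hle hyz)
        exact ⟨fun w e => Sum.inl_injective e ▸ hu, fun l' e => by simp at e⟩
  · intro h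
    induction h with
    | refl => exact .refl _
    | tail _ h ih => exact ih.trans (SimpleGraph.Adj.reachable h)

theorem self_mem_component (γ : Set (S.Node × S.Node)) (v : Fin S.size) :
    v ∈ S.component γ v := by
  simp [component]

theorem component_eq {γ : Set (S.Node × S.Node)} {v w : Fin S.size} (h : w ∈ S.component γ v) :
    S.component γ w = S.component γ v := by
  ext x
  simp only [component, Finset.mem_filter, Finset.mem_univ, true_and] at h ⊢
  exact ⟨fun h' => h.trans h', fun h' => h.symm.trans h'⟩

theorem IsCambrian.joinedIn_component (hS : S.IsCambrian) {γ : Set (S.Node × S.Node)}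
    {v w : Fin S.size} (h : w ∈ S.component γ v) :
    S.JoinedIn (· ∈ S.component γ v) v w := by
  rw [hS.mem_component_iff] at h
  induction h with
  | refl => exact .refl (self_mem_component γ v)
  | tail h h' ih =>
    exact ih.trans (.single ih.right (hS.mem_component_iff.2 (h.tail h'))
      (hS.adj_iff.2 (h'.imp And.left And.left)))

theorem IsCambrian.restrict_component (hS : S.IsCambrian) (γ : Set (S.Node × S.Node))
    (v : Fin S.size) : (S.restrict (S.component γ v)).IsCambrian :=
  hS.restrict ⟨v, self_mem_component γ v⟩ fun _ hu _ hw =>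
    (hS.joinedIn_component hu).symm.trans (hS.joinedIn_component hw)

theorem IsCambrian.isCambrian_of_mem_forest (hS : S.IsCambrian) {γ : Set (S.Node × S.Node)}
    {Q : Fin S.size → Prop} {T : LabeledDigraph} (hT : T ∈ S.forest γ Q) : T.IsCambrian := by
  obtain ⟨v, -, rfl⟩ := List.mem_map.1 hT
  exact hS.restrict_component γ v

/-! ### Cuts and lower sets -/

/-- The arcs from `K` and the down leaves to the complement of `K` and the up leaves. -/
def cutOf (S : LabeledDigraph) (K : Fin S.size → Prop) : Set (S.Node × S.Node) :=
  {e | S.Arc e.1 e.2 ∧ (∀ i, e.1 = Sum.inl i → K i) ∧ ∀ i, e.2 = Sum.inl i → ¬ K i}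

/-- `K` is closed under going down along arcs between inner vertices. -/
def IsLower (S : LabeledDigraph) (K : Fin S.size → Prop) : Prop :=
  ∀ i j, S.InnerArc i j → K j → K i

theorem exists_arc_into {x y z : S.Node} (h : S.Arc x y) (h' : Relation.ReflTransGen S.Arc y z) :
    ∃ t, S.Arc t z := by
  rcases Relation.ReflTransGen.cases_tail h' with rfl | ⟨t, -, ht⟩
  exacts [⟨x, h⟩, ⟨t, ht⟩]

theorem exists_arc_from {x y z : S.Node} (h : S.Arc y z) (h' : Relation.ReflTransGen S.Arc x y) :
    ∃ t, S.Arc x t := by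
  rcases Relation.ReflTransGen.cases_head h' with rfl | ⟨t, ht, -⟩
  exacts [⟨z, h⟩, ⟨t, ht⟩]

theorem reflTransGen_of_mem_darts {x y : S.Node} (p : S.graph.Walk x y)
    (hp : ∀ d ∈ p.darts, S.Arc d.fst d.snd) :
    ∀ d ∈ p.darts, Relation.ReflTransGen S.Arc x d.fst ∧ Relation.ReflTransGen S.Arc d.snd y := by
  have whole : ∀ {x y : S.Node} (p : S.graph.Walk x y), (∀ d ∈ p.darts, S.Arc d.fst d.snd) →
      Relation.ReflTransGen S.Arc x y := by
    intro x y p hp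
    induction p with
    | nil => exact .refl
    | cons h q ih =>
      simp only [SimpleGraph.Walk.darts_cons, List.mem_cons, forall_eq_or_imp] at hp
      exact .head hp.1 (ih hp.2)
  induction p with
  | nil => simp
  | cons h q ih =>
    simp only [SimpleGraph.Walk.darts_cons, List.mem_cons, forall_eq_or_imp] at hp ⊢
    exact ⟨⟨.refl, whole q hp.2⟩, fun d hd => ⟨.head hp.1 (ih hp.2 d hd).1, (ih hp.2 d hd).2⟩⟩

theorem isLower_isBelow (γ : Set (S.Node × S.Node)) : S.IsLower (S.IsBelow γ) :=
  fun _ _ h ⟨e, he, h'⟩ => ⟨e, he, .head h h'⟩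

namespace IsCambrian

variable (hS : S.IsCambrian)
include hS

theorem not_arc_through_leaf {x y : S.Node} {l : S.Leaf} (h : S.Arc x (Sum.inr l))
    (h' : S.Arc (Sum.inr l) y) : False := by
  obtain rfl := hS.leaf_unique (hS.adj_of_arc h).symm (hS.adj_of_arc h')
  exact hS.arc_asymm _ _ h h'

/-- The arc out of `y` matters: it ensures that no node after `x` on the directed path is a leaf,
where membership in `K` would be lost. -/
theorem lower_of_reflTransGen {K : Fin S.size → Prop} (hK : S.IsLower K) {x y z : S.Node}
    (h : Relation.ReflTransGen S.Arc x y) (hz : S.Arc y z) (hy : ∀ i, y = Sum.inl i → K i) :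
    ∀ i, x = Sum.inl i → K i := by
  induction h using Relation.ReflTransGen.head_induction_on with
  | refl => exact hy
  | @head x x' hx h ih =>
    rintro i rfl
    rcases x' with j | l
    · exact hK i j hx (ih j rfl)
    · obtain ⟨t, ht⟩ := exists_arc_from hz h
      exact (hS.not_arc_through_leaf hx ht).elim

theorem upper_of_reflTransGen {K : Fin S.size → Prop} (hK : S.IsLower K) {x y z : S.Node}
    (h : Relation.ReflTransGen S.Arc y x) (hz : S.Arc z y) (hy : ∀ i, y = Sum.inl i → ¬ K i) :
    ∀ i, x = Sum.inl i → ¬ K i := by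
  induction h with
  | refl => exact hy
  | @tail x' x h hx ih =>
    rintro i rfl
    rcases x' with j | l
    · exact fun hi => ih j rfl (hK j i hx hi)
    · obtain ⟨t, ht⟩ := exists_arc_into hz h
      exact (hS.not_arc_through_leaf ht hx).elim

/-- Climbing from a vertex of `K`, the first arc that leaves `K` or ends at an up leaf belongs to
the cut. -/
theorem isBelow_cutOf {K : Fin S.size → Prop} (hK : S.IsLower K) (v : Fin S.size) :
    S.IsBelow (S.cutOf K) v ↔ K v := by
  constructor
  · rintro ⟨e, he, h⟩
    exact hS.lower_of_reflTransGen hK h he.1 he.2.1 v rfl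
  · suffices ∀ x : S.Node, ∀ v, x = Sum.inl v → K v → S.IsBelow (S.cutOf K) v from this _ v rfl
    intro x
    induction x using hS.wellFounded_swap_arc.induction with
    | h x ih =>
      rintro v rfl hv
      obtain ⟨z, hz⟩ := hS.exists_parent v
      by_cases h : ∃ j, z = Sum.inl j ∧ K j
      · obtain ⟨j, rfl, hj⟩ := h
        obtain ⟨e, he, h⟩ := ih _ hz j rfl hj
        exact ⟨e, he, .head hz h⟩
      · refine ⟨(Sum.inl v, z), ⟨hz, fun i e => Sum.inl_injective e ▸ hv, fun i e hi => ?_⟩, .refl⟩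
        exact h ⟨i, e, hi⟩

theorem isAbove_cutOf {K : Fin S.size → Prop} (hK : S.IsLower K) (v : Fin S.size) :
    S.IsAbove (S.cutOf K) v ↔ ¬ K v := by
  constructor
  · rintro ⟨e, he, h⟩
    exact hS.upper_of_reflTransGen hK h he.1 he.2.2 v rfl
  · suffices ∀ x : S.Node, ∀ v, x = Sum.inl v → ¬ K v → S.IsAbove (S.cutOf K) v from this _ v rfl
    intro x
    induction x using hS.wellFounded_arc.induction with
    | h x ih =>
      rintro v rfl hv
      obtain ⟨z, hz⟩ := hS.exists_child v
      by_cases h : ∃ j, z = Sum.inl j ∧ ¬ K j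
      · obtain ⟨j, rfl, hj⟩ := h
        obtain ⟨e, he, h⟩ := ih _ hz j rfl hj
        exact ⟨e, he, .tail h hz⟩
      · refine ⟨(z, Sum.inl v), ⟨hz, fun i e => ?_, fun i e => Sum.inl_injective e ▸ hv⟩, .refl⟩
        by_contra hi
        exact h ⟨i, e, hi⟩

/-- A vertical path starts on the side of `K`, ends on the other side and can never return, so it
crosses exactly once. -/
theorem isCut_cutOf {K : Fin S.size → Prop} (hK : S.IsLower K) : S.IsCut (S.cutOf K) := by
  refine ⟨fun e he => he.1, fun x y p hx hy hp => ?_⟩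
  obtain ⟨⟨l, rfl⟩, t, ht⟩ := hx
  have low : ∀ i, (Sum.inr l : S.Node) = Sum.inl i → K i := fun i e => by simp at e
  replace hp := hp.2
  obtain ⟨⟨l', hl'⟩, t', ht'⟩ := hy
  -- From here on, the start may be any node that is not an inner vertex outside `K`, as the
  -- induction on tails requires.
  generalize (Sum.inr l : S.Node) = x at *
  induction p generalizing t with
  | nil =>
    subst hl'
    exact (hS.not_arc_through_leaf ht' ht).elim
  | @cons x z y h q ih =>
    simp only [SimpleGraph.Walk.darts_cons, List.mem_cons, forall_eq_or_imp] at hp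
    by_cases hz : ∃ j, z = Sum.inl j ∧ K j
    · obtain ⟨j, rfl, hj⟩ := hz
      obtain ⟨t, ht⟩ := hS.exists_parent j
      obtain ⟨d, hd, hu⟩ := ih t hl' ht' ht (fun i e => Sum.inl_injective e ▸ hj) hp.2
      refine ⟨d, ⟨List.mem_cons_of_mem _ hd.1, hd.2⟩, ?_⟩
      rintro d' ⟨hd', hc⟩
      rcases List.mem_cons.1 hd' with rfl | hd'
      · exact absurd hj (hc.2.2 j rfl)
      · exact hu d' ⟨hd', hc⟩
    · have hz' : ∀ i, z = Sum.inl i → ¬ K i := fun i e hi => hz ⟨i, e, hi⟩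
      refine ⟨⟨(x, z), h⟩, ⟨List.mem_cons_self, hp.1, low, hz'⟩, ?_⟩
      rintro d' ⟨hd', hc⟩
      rcases List.mem_cons.1 hd' with rfl | hd'
      · rfl
      · exfalso
        have hr := (reflTransGen_of_mem_darts q hp.2 d' hd').1
        have hup := hS.upper_of_reflTransGen hK hr hp.1 hz'
        obtain ⟨s, hs⟩ := exists_arc_into hp.1 hr
        have harc := hc.1
        have hlow := hc.2.1
        rcases hfst : d'.toProd.1 with i | l
        · exact hup i hfst (hlow i hfst)
        · rw [hfst] at hs harc
          exact hS.not_arc_through_leaf hs harc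

/-- Extend the arc to a vertical path between leaves; the cut meets it at the arc, after it or
before it. -/
theorem exists_mem_cut {γ : Set (S.Node × S.Node)} (hγ : S.IsCut γ) {x y : S.Node}
    (h : S.Arc x y) : ∃ e ∈ γ, e = (x, y) ∨ Relation.ReflTransGen S.Arc y e.1 ∨
      Relation.ReflTransGen S.Arc e.2 x := by
  obtain ⟨a, ha, hax⟩ := hS.exists_downLeaf h
  obtain ⟨b, hb, hyb⟩ := hS.exists_upLeaf h
  obtain ⟨p, hp⟩ := hS.exists_walk hax
  obtain ⟨q, hq⟩ := hS.exists_walk hyb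
  obtain ⟨d, ⟨hd, hdγ⟩, -⟩ := hγ.2 a b (p.append (.cons (hS.adj_of_arc h) q)) ha hb
    (hS.isVertical _ (by
      simp only [SimpleGraph.Walk.darts_append, SimpleGraph.Walk.darts_cons, List.mem_append,
        List.mem_cons]
      rintro d (hd | rfl | hd)
      exacts [hp d hd, h, hq d hd]))
  simp only [SimpleGraph.Walk.darts_append, SimpleGraph.Walk.darts_cons, List.mem_append,
    List.mem_cons] at hd
  refine ⟨_, hdγ, ?_⟩
  rcases hd with hd | rfl | hd
  · exact Or.inr (Or.inr (reflTransGen_of_mem_darts p hp d hd).2)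
  · exact Or.inl rfl
  · exact Or.inr (Or.inl (reflTransGen_of_mem_darts q hq d hd).1)

/-- Both arcs would lie on one vertical path between leaves, hence coincide, and the arc would close
a directed cycle. -/
theorem not_reflTransGen_of_mem_cut {γ : Set (S.Node × S.Node)} (hγ : S.IsCut γ)
    {e e' : S.Node × S.Node} (he : e ∈ γ) (he' : e' ∈ γ) :
    ¬ Relation.ReflTransGen S.Arc e.2 e'.1 := by
  intro h
  have harc := hγ.1 e he
  have harc' := hγ.1 e' he'
  obtain ⟨a, ha, hae⟩ := hS.exists_downLeaf harc
  obtain ⟨b, hb, heb⟩ := hS.exists_upLeaf harc'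
  obtain ⟨p, hp⟩ := hS.exists_walk hae
  obtain ⟨q, hq⟩ := hS.exists_walk h
  obtain ⟨r, hr⟩ := hS.exists_walk heb
  have key := (hγ.2 a b (p.append (.cons (hS.adj_of_arc harc)
    (q.append (.cons (hS.adj_of_arc harc') r)))) ha hb
    (hS.isVertical _ (by
      simp only [SimpleGraph.Walk.darts_append, SimpleGraph.Walk.darts_cons, List.mem_append,
        List.mem_cons]
      rintro d (hd | rfl | hd | rfl | hd)
      exacts [hp d hd, harc, hq d hd, harc', hr d hd]))).unique
    (y₁ := ⟨e, hS.adj_of_arc harc⟩) (y₂ := ⟨e', hS.adj_of_arc harc'⟩)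
    ⟨by simp, he⟩ ⟨by simp, he'⟩
  have : e = e' := congrArg SimpleGraph.Dart.toProd key
  subst this
  exact hS.not_transGen_self _ (Relation.TransGen.head' harc h)

theorem cutOf_isBelow {γ : Set (S.Node × S.Node)} (hγ : S.IsCut γ) :
    S.cutOf (S.IsBelow γ) = γ := by
  ext ⟨x, y⟩
  constructor
  · rintro ⟨h, hx, hy⟩
    simp only at h hx hy
    obtain ⟨e, he, rfl | h' | h'⟩ := hS.exists_mem_cut hγ h
    · exact he
    · exfalso
      rcases y with j | l
      · exact hy j rfl ⟨e, he, h'⟩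
      · obtain ⟨t, ht⟩ := exists_arc_from (hγ.1 e he) h'
        exact hS.not_arc_through_leaf h ht
    · exfalso
      rcases x with i | l
      · obtain ⟨e', he', h''⟩ := hx i rfl
        exact hS.not_reflTransGen_of_mem_cut hγ he he' (h'.trans h'')
      · obtain ⟨t, ht⟩ := exists_arc_into (hγ.1 e he) h'
        exact hS.not_arc_through_leaf ht h
  · intro h
    refine ⟨hγ.1 _ h, fun i hi => ⟨_, h, hi ▸ .refl⟩, fun i hi => ?_⟩
    rintro ⟨e, he, h'⟩
    exact hS.not_reflTransGen_of_mem_cut hγ h he (by rwa [hi])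

/-! ### Forests -/

/-- The hypothesis on `Q` covers both `K` and its complement. An arc between inner vertices is cut
exactly when its ends disagree about `K`, so the components are those of `K` and of its complement.
-/
theorem mem_component_cutOf {K Q : Fin S.size → Prop} (hK : S.IsLower K)
    (hQ : ∀ i j, Q i → (Q j ↔ (K i ↔ K j))) {v w : Fin S.size} (hv : Q v) :
    w ∈ S.component (S.cutOf K) v ↔ S.JoinedIn Q v w := by
  rw [hS.mem_component_iff]
  constructor
  · intro h
    induction h with
    | refl => exact .refl hv
    | @tail i j _ h ih =>
      have hij : K i ↔ K j := by
        rcases h with ⟨h, h'⟩ | ⟨h, h'⟩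
        · refine ⟨fun hi => ?_, hK i j h⟩
          by_contra hj
          exact h' ⟨h, fun k e => Sum.inl_injective e ▸ hi, fun k e => Sum.inl_injective e ▸ hj⟩
        · refine ⟨hK j i h, fun hj => ?_⟩
          by_contra hi
          exact h' ⟨h, fun k e => Sum.inl_injective e ▸ hj, fun k e => Sum.inl_injective e ▸ hi⟩
      exact ih.trans (.single ih.right ((hQ i j ih.right).2 hij)
        (hS.adj_iff.2 (h.imp And.left And.left)))
  · rintro ⟨p, hp⟩
    generalize hx : (Sum.inl v : S.Node) = x at p
    generalize hy : (Sum.inl w : S.Node) = y at p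
    induction p generalizing v with
    | nil =>
      subst hx
      rw [Sum.inl_injective hy]
    | cons h q ih =>
      subst hx
      obtain ⟨j, hj, rfl⟩ := hp _ (List.mem_cons_of_mem _ q.start_mem_support)
      have hvj := (hQ v j hv).1 hj
      refine .head ?_ (ih hj rfl hy fun z hz => hp z (List.mem_cons_of_mem _ hz))
      exact (hS.adj_iff.1 h).imp
        (fun h => ⟨h, fun hc => hc.2.2 j rfl (hvj.1 (hc.2.1 v rfl))⟩)
        (fun h => ⟨h, fun hc => hc.2.2 v rfl (hvj.2 (hc.2.1 j rfl))⟩)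

theorem prod_forest (R : Type*) [CommRing R] {K Q : Fin S.size → Prop} (hK : S.IsLower K)
    (hQ : ∀ i j, Q i → (Q j ↔ (K i ↔ K j)))
    (hsep : ∀ x y, Q x → Q y → ¬ S.JoinedIn Q x y →
      (∀ x' y', S.JoinedIn Q x x' → S.JoinedIn Q y y' → x' < y') ∨
      (∀ x' y', S.JoinedIn Q x x' → S.JoinedIn Q y y' → y' < x'))
    {I : Finset (Fin S.size)} (hI : ∀ i, i ∈ I ↔ Q i) :
    ((S.forest (S.cutOf K) Q).map fun T => T.P R).prod =
      extSumOn S.signature S.InnerArc R I := by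
  classical
  have mem : ∀ {v w}, Q v → (w ∈ S.component (S.cutOf K) v ↔ S.JoinedIn Q v w) :=
    fun hv => hS.mem_component_cutOf hK hQ hv
  rw [forest, List.map_map]
  have hP : (fun T => T.P R) ∘ (fun v => S.restrict (S.component (S.cutOf K) v)) =
      fun v => extSumOn S.signature S.InnerArc R (S.component (S.cutOf K) v) :=
    funext fun v => hS.P_restrict R _
  rw [hP]
  apply extSumOn_list_prod
  · refine List.Pairwise.imp_of_mem ?_ (Finset.sortedLT_sort _).pairwise
    intro v w hv hw hvw i hi j hj
    simp only [Finset.mem_sort, Finset.mem_filter, Finset.mem_univ, true_and] at hv hw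
    -- Each listed vertex is the smallest of its component, so the earlier `v` cannot lie in that of
    -- `w`.
    have hni : ¬ S.JoinedIn Q v w := fun h =>
      absurd (hw.2 v ((mem hw.1).2 h.symm)) (not_le.2 hvw)
    rw [mem hv.1] at hi
    rw [mem hw.1] at hj
    refine ⟨?_, fun h => ?_, fun h => ?_⟩
    · rcases hsep v w hv.1 hw.1 hni with h | h
      · exact h i j hi hj
      · exact absurd (h v w (.refl hv.1) (.refl hw.1)) hvw.not_gt
    · exact hni ((hi.trans (.single hi.right hj.right (hS.adj_of_arc h))).trans hj.symm)
    · exact hni ((hi.trans (.single hi.right hj.right (hS.adj_of_arc h).symm)).trans hj.symm)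
  · intro x
    simp only [hI, Finset.mem_sort, Finset.mem_filter, Finset.mem_univ, true_and]
    constructor
    · intro hx
      have hne : (S.component (S.cutOf K) x).Nonempty := ⟨x, self_mem_component _ x⟩
      have hm := (S.component (S.cutOf K) x).min'_mem hne
      -- The component of `x` is listed at its smallest vertex.
      refine ⟨_, ⟨((mem hx).1 hm).right, fun w hw => ?_⟩, ?_⟩
      · rw [component_eq hm] at hw
        exact Finset.min'_le _ _ hw
      · rw [component_eq hm]
        exact self_mem_component _ x
    · rintro ⟨v, ⟨hv, -⟩, hx⟩
      exact ((mem hv).1 hx).right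

theorem prod_forestBelow_cutOf (R : Type*) [CommRing R] {I : Finset (Fin S.size)}
    (hI : S.IsLower (· ∈ I)) :
    ((S.forestBelow (S.cutOf (· ∈ I))).map fun T => T.P R).prod =
      extSumOn S.signature S.InnerArc R I := by
  rw [forestBelow, funext fun v => propext (hS.isBelow_cutOf hI v)]
  exact hS.prod_forest R hI (fun i j hi => by simp [hi])
    (fun x y hx hy => hS.separated_of_lower hI hx hy) fun _ => Iff.rfl

theorem prod_forestAbove_cutOf (R : Type*) [CommRing R] {I : Finset (Fin S.size)}
    (hI : S.IsLower (· ∈ I)) :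
    ((S.forestAbove (S.cutOf (· ∈ I))).map fun T => T.P R).prod =
      extSumOn S.signature S.InnerArc R Iᶜ := by
  rw [forestAbove, funext fun v => propext (hS.isAbove_cutOf hI v)]
  exact hS.prod_forest R hI (fun i j hi => by simp [hi])
    (fun x y hx hy => hS.separated_of_upper (fun i j h hi hj => hi (hI i j h hj)) hx hy)
    fun _ => Finset.mem_compl

end IsCambrian

end LabeledDigraph

/-! ### The coproduct formula -/

theorem mainTheorem3 (R : Type*) [CommRing R] (S : LabeledDigraph) (hS : S.IsCambrian) :
    (∀ γ ∈ S.cuts, ∀ T ∈ S.forestBelow γ ++ S.forestAbove γ, T.IsCambrian) ∧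
    FQSym.coproduct R (S.P R) =
      ∑ γ ∈ S.cuts,
        ((S.forestBelow γ).map fun T => T.P R).prod ⊗ₜ[R]
          ((S.forestAbove γ).map fun T => T.P R).prod := by
  classical
  refine ⟨fun γ _ T hT => (List.mem_append.1 hT).elim hS.isCambrian_of_mem_forest
    hS.isCambrian_of_mem_forest, ?_⟩
  rw [S.P_eq_extSum, coproduct_extSum]
  have lower : ∀ {I : Finset (Fin S.size)}, I ∈ (Finset.univ.filter fun I : Finset (Fin S.size) =>
      ∀ u w, S.InnerArc u w → w ∈ I → u ∈ I) → S.IsLower (· ∈ I) :=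
    fun hI => (Finset.mem_filter.1 hI).2
  refine Finset.sum_bij (fun I _ => S.cutOf (· ∈ I)) ?_ ?_ ?_ ?_
  · intro I hI
    simpa [LabeledDigraph.cuts] using hS.isCut_cutOf (lower hI)
  · intro I hI J hJ h
    ext v
    rw [← hS.isBelow_cutOf (lower hI), h, hS.isBelow_cutOf (lower hJ)]
  · intro γ hγ
    have hγ' : S.IsCut γ := by simpa [LabeledDigraph.cuts] using hγ
    -- The lower set belonging to a cut consists of the vertices below it.
    refine ⟨Finset.univ.filter (S.IsBelow γ), ?_, ?_⟩
    · simp only [Finset.mem_filter, Finset.mem_univ, true_and]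
      exact LabeledDigraph.isLower_isBelow γ
    · simpa using hS.cutOf_isBelow hγ'
  · intro I hI
    rw [hS.prod_forestBelow_cutOf R (lower hI), hS.prod_forestAbove_cutOf R (lower hI)]
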